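/- Setting. Let $X\subseteq\mathbb R^n$ be open, let $X_0,X_r,X_u\subseteq X$ (initial, target and unsafe set) with $X_r$ closed in $X$ and $X_u$ Borel, let $F:\mathbb R^n\times\mathbb R^m\to\mathbb R^n$, let $l:\mathbb R^n\times\mathbb R^m\to\mathbb R$ be a measurable running cost, and let $h_0\ge 0$ be a measurable probability density that vanishes outside $X_0$. A policy is a measurable $u:\mathbb R^n\to\mathbb R^m$ such that $x\mapsto F(x,u(x))$ is locally Lipschitz on $X$ and, for every $x\in X$, the equation $\dot x(t)=F(x(t),u(x(t)))$, $x(0)=x$, has a solution $s_t(x)\in X$ for all $t\ge0$. For $t\ge 0$, $\mathbb P_th_0$ denotes the density with $\int_A\mathbb P_th_0\,dx=\int_{\{x\in X:\,s_t(x)\in A\}}h_0\,dx$ for all Borel $A\subseteq X$, taken jointly measurable in $(t,x)$, and $\rho=\int_0^\infty\mathbb P_th_0\,dt$, with values in $[0,\infty]$, is the occupancy density of $u$. Write $$J(u)=\int_X\int_0^\infty l(s_t(x),u(s_t(x)))\,dt\,h_0(x)\,dx .$$ Call $u$ safe if $\int_0^\infty\mathbf 1_{X_u}(s_t(x))\,dt=0$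 for all $x\in X_0$, and a.e. safe if this holds for $h_0$-almost every $x$. Say that $u$ drives $X_0$ to $X_r$ if for every $x\in X_0$ one has $s_t(x)\in X_r$ for all sufficiently large $t$, and that $u$ has locally finite occupancy if $\int_X\int_0^\infty\mathbf 1_K(s_t(x))\,dt\,h_0(x)\,dx<\infty$ for each compact $K\subset X\setminus X_r$. (A) Let $u$ be a policy. Its occupancy density $\rho$ exists and is unique up to null sets in $X$, and: 1. If $l\ge0$ on $X\times\mathbb R^m$, then $J(u)=\int_Xl(x,u(x))\rho(x)\,dx$ in $[0,\infty]$. For $l$ of any sign, if $\int_X\int_0^\infty|l(s_t(x),u(s_t(x)))|\,dt\,h_0(x)\,dx<\infty$, then $l(\cdot,u(\cdot))\rho$ is integrable on $X$ and the same identity holds. 2. $\int_A\rho\,dx=\int_X\int_0^\infty\mathbf 1_A(s_t(x))\,dt\,h_0(x)\,dx$ for every Borel $A\subseteq X$, and $u$ is a.e. safe if and only if $\int_{X_u}\rho\,dx=0$. A safe policy is a.e. safe; the converse holds if $X_u$ is open and every neighbourhood of every point of $X_0$ has positive $h_0$-mass. 3. If $u$ drives $X_0$ to $X_r$ and has locally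 finite occupancy, then $\rho$ is locally integrable on $X\setminus X_r$ and $$\nabla\cdot\big(F(x,u(x))\rho(x)\big)=h_0(x)\quad\text{on }X\setminus X_r$$ in the sense of distributions. The equation holds pointwise on each open $V\subseteq X\setminus X_r$ on which $h_0$ is continuous and $\rho$ has a representative $g$ for which $F(\cdot,u(\cdot))g$ is $C^1$. (B) Let $l\ge 0$ on $X\times\mathbb R^m$ and let $\mathcal U$ be any set of policies that drive $X_0$ to $X_r$ and have locally finite occupancy. Consider the occupancy problem $$\inf_{\rho,u}\int_Xl(x,u(x))\rho(x)\,dx\quad\text{s.t.}\quad\nabla\cdot(F(x,u(x))\rho(x))=h_0(x)\ \text{on }X\setminus X_r,\qquad\int_{X_u}\rho(x)\,dx=0,$$ where $u\in\mathcal U$, $\rho:\mathbb R^n\to[0,\infty]$ is measurable and locally integrable on $X\setminus X_r$, and the equation is meant in the sense of distributions. 1. If $u\in\mathcal U$ has occupancy density $\rho$, then $(\rho,u)$ is feasible if and only if $u$ is a.e. safe. The value of the occupancy problem restricted to such pairs equals $\inf\{J(u):u\in\mathcal U\text{ a.e. safe}\}$. 2. Suppose in addition that $X_u\cap X_r=\emptyset$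 and that, for each $u\in\mathcal U$, trajectories from $X_0$ do not leave $X_r$ once they have entered it and $l(x,u(x))=0$ for $x\in X_r$. Then every feasible pair $(\rho,u)$ has $u$ a.e. safe and $J(u)\le\int_Xl(x,u(x))\rho(x)\,dx$, and the value of the full occupancy problem, with $\rho$ ranging over all nonnegative solutions, equals $\inf\{J(u):u\in\mathcal U\text{ a.e. safe}\}$. 3. If $X_u$ is open and every neighbourhood of every point of $X_0$ has positive $h_0$-mass, then $\inf\{J(u):u\in\mathcal U\text{ safe}\}=\inf\{J(u):u\in\mathcal U\text{ a.e. safe}\}$. -/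

import Mathlib

open MeasureTheory Set Filter Topology
open scoped ENNReal

noncomputable section

/-- The data of a safety-constrained optimal control problem on an open state domain
`X ⊆ ℝⁿ`, with controls in `ℝᵐ`. -/
structure SafeControlProblem (n m : ℕ) where
  /-- state domain -/
  X : Set (EuclideanSpace ℝ (Fin n))
  /-- initial set -/
  X₀ : Set (EuclideanSpace ℝ (Fin n))
  /-- target set -/
  Xr : Set (EuclideanSpace ℝ (Fin n))
  /-- unsafe set -/
  Xu : Set (EuclideanSpace ℝ (Fin n))
  /-- controlled vector field -/
  F : EuclideanSpace ℝ (Fin n) → EuclideanSpace ℝ (Fin m) → EuclideanSpace ℝ (Fin n)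
  /-- running cost -/
  l : EuclideanSpace ℝ (Fin n) → EuclideanSpace ℝ (Fin m) → ℝ
  /-- initial probability density -/
  h₀ : EuclideanSpace ℝ (Fin n) → ℝ
  isOpen_X : IsOpen X
  X₀_subset : X₀ ⊆ X
  Xr_subset : Xr ⊆ X
  Xu_subset : Xu ⊆ X
  /-- the target set is closed relative to `X` -/
  isOpen_diff : IsOpen (X \ Xr)
  measurableSet_Xu : MeasurableSet Xu
  measurable_l : Measurable (Function.uncurry l)
  measurable_h₀ : Measurable h₀
  h₀_nonneg : ∀ x, 0 ≤ h₀ x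
  /-- `h₀` is supported on `X₀` -/
  h₀_eq_zero : ∀ x, x ∉ X₀ → h₀ x = 0
  lintegral_h₀ : ∫⁻ x, ENNReal.ofReal (h₀ x) = 1

namespace SafeControlProblem

variable {n m : ℕ} (P : SafeControlProblem n m)

/-- The closed-loop vector field `x ↦ F(x, u(x))` of a feedback policy. -/
def field (u : EuclideanSpace ℝ (Fin n) → EuclideanSpace ℝ (Fin m)) :
    EuclideanSpace ℝ (Fin n) → EuclideanSpace ℝ (Fin n) :=
  fun x => P.F x (u x)

/-- `γ` is a solution in `X`, on the time interval `[0, ∞)`, of the closed-loop system started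
at `x`. -/
def IsTrajectory (u : EuclideanSpace ℝ (Fin n) → EuclideanSpace ℝ (Fin m))
    (x : EuclideanSpace ℝ (Fin n)) (γ : ℝ → EuclideanSpace ℝ (Fin n)) : Prop :=
  γ 0 = x ∧ ∀ t, 0 ≤ t → γ t ∈ P.X ∧ HasDerivWithinAt γ (P.field u (γ t)) (Ici 0) t

/-- Feedback policies for which the closed-loop system is well posed on `X`: the closed-loop
vector field is locally Lipschitz (so that solutions are unique) and every initial state in `X`
has a solution that exists, and stays in `X`, for all `t ≥ 0`. -/
structure IsPolicy (u : EuclideanSpace ℝ (Fin n) → EuclideanSpace ℝ (Fin m)) : Prop where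
  measurable : Measurable u
  locallyLipschitz : LocallyLipschitzOn P.X (P.field u)
  exists_trajectory : ∀ x ∈ P.X, ∃ γ, P.IsTrajectory u x γ

open Classical in
/-- The solution `s_t(x)` of the closed-loop system (with value `x` where there is none). -/
def flow (u : EuclideanSpace ℝ (Fin n) → EuclideanSpace ℝ (Fin m)) (t : ℝ)
    (x : EuclideanSpace ℝ (Fin n)) : EuclideanSpace ℝ (Fin n) :=
  if h : ∃ γ, P.IsTrajectory u x γ then h.choose t else x

/-- `p t` is, for every `t ≥ 0`, the image `ℙ_t h₀` of the initial density under the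
Perron–Frobenius operator of the closed-loop system: for Borel `A ⊆ X`,
`∫_{s_{-t}(A)} h₀ = ∫_A ℙ_t h₀`. The representatives are chosen jointly measurable in `(t, x)`. -/
def IsPerronFrobenius (u : EuclideanSpace ℝ (Fin n) → EuclideanSpace ℝ (Fin m))
    (p : ℝ → EuclideanSpace ℝ (Fin n) → ℝ≥0∞) : Prop :=
  Measurable (Function.uncurry p) ∧
    ∀ t, 0 ≤ t → ∀ A : Set (EuclideanSpace ℝ (Fin n)), MeasurableSet A → A ⊆ P.X →
      ∫⁻ x in {x ∈ P.X | P.flow u t x ∈ A}, ENNReal.ofReal (P.h₀ x) = ∫⁻ x in A, p t x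

/-- `ρ = ∫₀^∞ ℙ_t h₀ dt`, the occupancy density of the policy `u`. -/
def IsOccupancyDensity (u : EuclideanSpace ℝ (Fin n) → EuclideanSpace ℝ (Fin m))
    (ρ : EuclideanSpace ℝ (Fin n) → ℝ≥0∞) : Prop :=
  ∃ p, P.IsPerronFrobenius u p ∧ ∀ x, ρ x = ∫⁻ t in Ici (0 : ℝ), p t x

/-- The time `∫₀^∞ 𝟙_A(s_t(x)) dt` that the trajectory from `x` spends in `A`. -/
def timeIn (u : EuclideanSpace ℝ (Fin n) → EuclideanSpace ℝ (Fin m))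
    (A : Set (EuclideanSpace ℝ (Fin n))) (x : EuclideanSpace ℝ (Fin n)) : ℝ≥0∞ :=
  ∫⁻ t in Ici (0 : ℝ), A.indicator 1 (P.flow u t x)

/-- The expected cost `J(h₀) = ∫_X ∫₀^∞ l(s_t(x), u(s_t(x))) dt h₀(x) dx` for a nonnegative
running cost, with values in `[0, ∞]`. -/
def cost (u : EuclideanSpace ℝ (Fin n) → EuclideanSpace ℝ (Fin m)) : ℝ≥0∞ :=
  ∫⁻ x in P.X, (∫⁻ t in Ici (0 : ℝ),
    ENNReal.ofReal (P.l (P.flow u t x) (u (P.flow u t x)))) * ENNReal.ofReal (P.h₀ x)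

/-- The objective `∫_X l(x, u(x)) ρ(x) dx` for a nonnegative running cost. -/
def occupancyCost (u : EuclideanSpace ℝ (Fin n) → EuclideanSpace ℝ (Fin m))
    (ρ : EuclideanSpace ℝ (Fin n) → ℝ≥0∞) : ℝ≥0∞ :=
  ∫⁻ x in P.X, ENNReal.ofReal (P.l x (u x)) * ρ x

/-- Safety from every initial state in `X₀`. -/
def IsSafe (u : EuclideanSpace ℝ (Fin n) → EuclideanSpace ℝ (Fin m)) : Prop :=
  ∀ x ∈ P.X₀, P.timeIn u P.Xu x = 0

/-- Safety from almost every initial state with respect to `h₀`. -/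
def IsSafeAE (u : EuclideanSpace ℝ (Fin n) → EuclideanSpace ℝ (Fin m)) : Prop :=
  ∀ᵐ x ∂(volume.withDensity fun x => ENNReal.ofReal (P.h₀ x)), P.timeIn u P.Xu x = 0

/-- Every trajectory from `X₀` is driven into `X_r`, to remain there from some time on. -/
def DrivesToTarget (u : EuclideanSpace ℝ (Fin n) → EuclideanSpace ℝ (Fin m)) : Prop :=
  ∀ x ∈ P.X₀, ∃ T, 0 ≤ T ∧ ∀ t, T ≤ t → P.flow u t x ∈ P.Xr

/-- Trajectories from `X₀` do not leave `X_r` again after entering it. -/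
def StaysInTarget (u : EuclideanSpace ℝ (Fin n) → EuclideanSpace ℝ (Fin m)) : Prop :=
  ∀ x ∈ P.X₀, ∀ r t, 0 ≤ r → r ≤ t → P.flow u r x ∈ P.Xr → P.flow u t x ∈ P.Xr

/-- The expected time spent in each compact subset of `X \ X_r` is finite. -/
def HasFiniteOccupancy (u : EuclideanSpace ℝ (Fin n) → EuclideanSpace ℝ (Fin m)) : Prop :=
  ∀ K : Set (EuclideanSpace ℝ (Fin n)), IsCompact K → K ⊆ P.X \ P.Xr →
    ∫⁻ x in P.X, P.timeIn u K x * ENNReal.ofReal (P.h₀ x) < ⊤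

/-- `ρ` is locally integrable on the open set `X \ X_r` and satisfies there
`∇·(F(x, u(x)) ρ) = h₀` in the sense of distributions. -/
def SolvesLiouville (u : EuclideanSpace ℝ (Fin n) → EuclideanSpace ℝ (Fin m))
    (ρ : EuclideanSpace ℝ (Fin n) → ℝ≥0∞) : Prop :=
  (∀ K : Set (EuclideanSpace ℝ (Fin n)), IsCompact K → K ⊆ P.X \ P.Xr →
    ∫⁻ x in K, ρ x < ⊤) ∧
  ∀ φ : EuclideanSpace ℝ (Fin n) → ℝ, ContDiff ℝ (⊤ : ℕ∞) φ → HasCompactSupport φ →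
    tsupport φ ⊆ P.X \ P.Xr →
      -∫ x in P.X \ P.Xr, fderiv ℝ φ x (P.field u x) * (ρ x).toReal =
        ∫ x in P.X \ P.Xr, φ x * P.h₀ x

/-- The constraints of the occupancy problem on a pair `(ρ, u)` with `ρ ≥ 0`. -/
structure IsFeasible (u : EuclideanSpace ℝ (Fin n) → EuclideanSpace ℝ (Fin m))
    (ρ : EuclideanSpace ℝ (Fin n) → ℝ≥0∞) : Prop where
  measurable : Measurable ρ
  liouville : P.SolvesLiouville u ρ
  safe : ∫⁻ x in P.Xu, ρ x = 0

/-- Value, over a class `𝒰` of policies, of the optimal control problem with the safety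
constraint imposed on all initial states in `X₀`. -/
def controlValue (𝒰 : Set (EuclideanSpace ℝ (Fin n) → EuclideanSpace ℝ (Fin m))) : ℝ≥0∞ :=
  ⨅ u ∈ {u ∈ 𝒰 | P.IsSafe u}, P.cost u

/-- Value of the optimal control problem with the safety constraint imposed on `h₀`-almost all
initial states. -/
def controlValueAE (𝒰 : Set (EuclideanSpace ℝ (Fin n) → EuclideanSpace ℝ (Fin m))) : ℝ≥0∞ :=
  ⨅ u ∈ {u ∈ 𝒰 | P.IsSafeAE u}, P.cost u

/-- Value of the occupancy problem over pairs `(ρ, u)`, with `ρ` any nonnegative solution. -/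
def occupancyValue (𝒰 : Set (EuclideanSpace ℝ (Fin n) → EuclideanSpace ℝ (Fin m))) : ℝ≥0∞ :=
  ⨅ u ∈ 𝒰, ⨅ ρ ∈ {ρ | P.IsFeasible u ρ}, P.occupancyCost u ρ

/-- Value of the occupancy problem over pairs `(ρ, u)` in which `ρ` is the occupancy density
of `u`. -/
def occupancyValueOfDensity
    (𝒰 : Set (EuclideanSpace ℝ (Fin n) → EuclideanSpace ℝ (Fin m))) : ℝ≥0∞ :=
  ⨅ u ∈ 𝒰, ⨅ ρ ∈ {ρ | P.IsFeasible u ρ ∧ P.IsOccupancyDensity u ρ}, P.occupancyCost u ρ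

end SafeControlProblem

/-- The (classical) divergence of a vector field on `ℝⁿ`. -/
def divergence {n : ℕ} (w : EuclideanSpace ℝ (Fin n) → EuclideanSpace ℝ (Fin n))
    (x : EuclideanSpace ℝ (Fin n)) : ℝ :=
  ∑ i, fderiv ℝ w x (EuclideanSpace.single i 1) i

end

/-! Near each initial state and up to a finite time, a policy's flow coincides with the flow of a
globally Lipschitz cut-off field. By Gronwall in reversed time that flow is antilipschitz, so
preimages of null sets are null and the law of `s_t` has a density. Kernel Radon–Nikodym makes these
densities jointly measurable in `(t, x)`, and Tonelli gives the occupancy identity `∫ g ρ = ∫ (∫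
g(s_t) dt) dP₀`, where `P₀` has density `h₀` (`IsOccupancyDensity.setLIntegral_mul`). The cost
formula, the safety criterion and uniqueness are instances of it. For `g = ∇φ · F` the inner
integral is that of `d/dt φ(s_t)`; it equals `-φ(x)` because the trajectory ends in `X_r`, where `φ`
vanishes. This is the weak Liouville equation.

The full occupancy problem rests on minimality: every nonnegative solution `ρ` of the Liouville
equation dominates the occupancy density outside `X_r` (`SolvesLiouville.occupancyDensity_le`). The
test function is `φ = ∫₀ᵀ ψ ∘ Ψ_t dt`, with `ψ ≥ 0` and `Ψ` the semiflow of a field `χF` cut off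
inside `X \ X_r`. Since `χ F · ∇φ = ψ ∘ Ψ_T - ψ` and `χ = 1` on the support of `ψ`, `-F · ∇φ ≤ ψ`
almost everywhere, and the equation yields `∫ φ dP₀ ≤ ∫ ψ ρ`. Such `φ` is only Lipschitz, so the
equation is first extended to Lipschitz test functions by mollification. When trajectories never
leave `X_r` again, letting the cut-offs exhaust `X \ X_r` and `T → ∞` replaces `Ψ` by the true flow.
-/

noncomputable section

open scoped NNReal Convolution

/-! ### Semiflows of globally Lipschitz autonomous equations -/

section GlobalODE

variable {E : Type*} [NormedAddCommGroup E] [NormedSpace ℝ E]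

/-- `γ` solves the autonomous equation `γ' = v(γ)` on `[0, T]`. -/
def SolvesOn (v : E → E) (γ : ℝ → E) (T : ℝ) : Prop :=
  ∀ t ∈ Icc 0 T, HasDerivWithinAt γ (v (γ t)) (Icc 0 T) t

/-- `Ψ` is the semiflow on `[0, ∞)` of the autonomous equation with vector field `v`. -/
structure IsSemiflow (v : E → E) (Ψ : ℝ → E → E) : Prop where
  map_zero : ∀ x, Ψ 0 x = x
  hasDerivWithinAt : ∀ x t, 0 ≤ t → HasDerivWithinAt (fun r => Ψ r x) (v (Ψ t x)) (Ici 0) t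

variable {v : E → E} {γ γ' : ℝ → E} {T : ℝ} {K : ℝ≥0} {Ψ : ℝ → E → E}

theorem SolvesOn.continuousOn (h : SolvesOn v γ T) : ContinuousOn γ (Icc 0 T) :=
  fun t ht => (h t ht).continuousWithinAt

theorem SolvesOn.mono (h : SolvesOn v γ T) {S : ℝ} (hS : S ≤ T) : SolvesOn v γ S :=
  fun t ht => (h t ⟨ht.1, ht.2.trans hS⟩).mono (Icc_subset_Icc_right hS)

theorem SolvesOn.hasDerivWithinAt_Ici (h : SolvesOn v γ T) {t : ℝ} (ht : t ∈ Ico 0 T) :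
    HasDerivWithinAt γ (v (γ t)) (Ici t) t :=
  ((h t ⟨ht.1, ht.2.le⟩).mono (Icc_subset_Icc_left ht.1)).mono_of_mem_nhdsWithin
    (Icc_mem_nhdsGE ht.2)

theorem SolvesOn.congr_field (h : SolvesOn v γ T) {w : E → E}
    (hw : ∀ t ∈ Icc 0 T, w (γ t) = v (γ t)) : SolvesOn w γ T :=
  fun t ht => by rw [hw t ht]; exact h t ht

theorem SolvesOn.dist_le (hv : LipschitzWith K v) (h : SolvesOn v γ T) (h' : SolvesOn v γ' T)
    {t : ℝ} (ht : t ∈ Icc 0 T) :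
    dist (γ t) (γ' t) ≤ dist (γ 0) (γ' 0) * Real.exp (K * t) := by
  have := dist_le_of_trajectories_ODE (v := fun _ => v) (fun _ => hv) h.continuousOn
    (fun t ht => h.hasDerivWithinAt_Ici ht) h'.continuousOn
    (fun t ht => h'.hasDerivWithinAt_Ici ht) le_rfl t ht
  simpa using this

theorem SolvesOn.eqOn (hv : LipschitzWith K v) (h : SolvesOn v γ T) (h' : SolvesOn v γ' T)
    (h0 : γ 0 = γ' 0) : EqOn γ γ' (Icc 0 T) := fun t ht => by
  have := h.dist_le hv h' ht
  rw [h0, dist_self, zero_mul] at this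
  exact dist_le_zero.1 this

theorem SolvesOn.reverse (h : SolvesOn v γ T) :
    SolvesOn (fun x => -v x) (fun t => γ (T - t)) T := fun t ht => by
  have hm : MapsTo (fun r : ℝ => T - r) (Icc 0 T) (Icc 0 T) := fun r hr =>
    ⟨by linarith [hr.2], by linarith [hr.1]⟩
  have h2 : HasDerivWithinAt (fun r : ℝ => T - r) (-1) (Icc 0 T) t := by
    simpa using (hasDerivWithinAt_id t (Icc 0 T)).const_sub T
  have := (h (T - t) (hm ht)).scomp t h2 hm
  simpa [Function.comp_def] using this

/-- Gronwall for the reversed solutions: trajectories separate at most exponentially backwards in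
time as well. This is the source of the antilipschitz bound. -/
theorem SolvesOn.dist_zero_le (hv : LipschitzWith K v) (h : SolvesOn v γ T)
    (h' : SolvesOn v γ' T) (hT : 0 ≤ T) :
    dist (γ 0) (γ' 0) ≤ dist (γ T) (γ' T) * Real.exp (K * T) := by
  have := SolvesOn.dist_le (v := fun x => -v x) hv.neg h.reverse h'.reverse
    (t := T) ⟨hT, le_rfl⟩
  simpa using this

/-- A field bounded by `M` moves a point at most `M * T` in time `T`, so Picard–Lindelöf on the ball
of that radius covers the whole interval at once. -/
theorem exists_solvesOn [CompleteSpace E] (hv : LipschitzWith K v) {M : ℝ≥0}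
    (hM : ∀ x, ‖v x‖ ≤ M) (hT : 0 ≤ T) (x : E) : ∃ γ : ℝ → E, γ 0 = x ∧ SolvesOn v γ T := by
  have hp : IsPicardLindelof (fun _ => v) (⟨0, le_rfl, hT⟩ : Icc (0 : ℝ) T) x
      (M * T.toNNReal) 0 M K :=
    .of_time_independent (fun y _ => hM y) hv.lipschitzOnWith (by simp [hT])
  exact hp.exists_eq_forall_mem_Icc_hasDerivWithinAt₀

theorem exists_isSemiflow [CompleteSpace E] (hv : LipschitzWith K v) {M : ℝ≥0}
    (hM : ∀ x, ‖v x‖ ≤ M) : ∃ Ψ, IsSemiflow v Ψ := by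
  choose γ hγ0 hγ using fun (x : E) (N : ℕ) => exists_solvesOn hv hM (Nat.cast_nonneg N) x
  have key : ∀ x (N : ℕ) (t : ℝ), 0 ≤ t → t ≤ N → γ x ⌈t⌉₊ t = γ x N t := fun x N t h0 hN =>
    SolvesOn.eqOn hv (hγ x ⌈t⌉₊) ((hγ x N).mono (by exact_mod_cast Nat.ceil_le.2 hN))
      (by rw [hγ0, hγ0]) ⟨h0, Nat.le_ceil t⟩
  refine ⟨fun t x => γ x ⌈t⌉₊ t, fun x => hγ0 x _, fun x t ht => ?_⟩
  -- One unit beyond `⌈t⌉₊` puts `t` strictly below the right endpoint, even for integer `t`, so the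
  -- derivative within the interval is one within `Ici 0`.
  have ht' : t < (⌈t⌉₊ + 1 : ℕ) := by push_cast; linarith [Nat.le_ceil t]
  have h1 := hγ x (⌈t⌉₊ + 1) t ⟨ht, ht'.le⟩
  rw [key x _ t ht ht'.le]
  have h2 : HasDerivWithinAt (fun r => γ x ⌈r⌉₊ r) (v (γ x (⌈t⌉₊ + 1) t))
      (Icc 0 ((⌈t⌉₊ + 1 : ℕ) : ℝ)) t :=
    h1.congr (fun r hr => key x _ r hr.1 hr.2) (key x _ t ht ht'.le)
  refine h2.mono_of_mem_nhdsWithin ?_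
  rw [← Ici_inter_Iic]
  exact inter_mem self_mem_nhdsWithin (mem_nhdsWithin_of_mem_nhds (Iic_mem_nhds ht'))

theorem IsSemiflow.solvesOn (h : IsSemiflow v Ψ) (x : E) (T : ℝ) :
    SolvesOn v (fun t => Ψ t x) T :=
  fun t ht => (h.hasDerivWithinAt x t ht.1).mono Icc_subset_Ici_self

theorem IsSemiflow.eq_of_solvesOn (hv : LipschitzWith K v) (h : IsSemiflow v Ψ)
    (hγ : SolvesOn v γ T) {t : ℝ} (ht : t ∈ Icc 0 T) : Ψ t (γ 0) = γ t :=
  (h.solvesOn (γ 0) T).eqOn hv hγ (h.map_zero _) ht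

theorem IsSemiflow.dist_le (hv : LipschitzWith K v) (h : IsSemiflow v Ψ) {t : ℝ} (ht : 0 ≤ t)
    (x y : E) : dist (Ψ t x) (Ψ t y) ≤ dist x y * Real.exp (K * t) := by
  simpa [h.map_zero] using (h.solvesOn x t).dist_le hv (h.solvesOn y t) ⟨ht, le_rfl⟩

theorem IsSemiflow.lipschitzWith (hv : LipschitzWith K v) (h : IsSemiflow v Ψ) {t : ℝ}
    (ht : 0 ≤ t) (htT : t ≤ T) : LipschitzWith (Real.exp (K * T)).toNNReal (Ψ t) := by
  refine LipschitzWith.of_dist_le_mul fun x y => (h.dist_le hv ht x y).trans ?_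
  rw [mul_comm, Real.coe_toNNReal _ (Real.exp_pos _).le]
  gcongr

theorem IsSemiflow.antilipschitzWith (hv : LipschitzWith K v) (h : IsSemiflow v Ψ) {t : ℝ}
    (ht : 0 ≤ t) : AntilipschitzWith (Real.exp (K * t)).toNNReal (Ψ t) := by
  refine AntilipschitzWith.of_le_mul_dist fun x y => ?_
  have := (h.solvesOn x t).dist_zero_le hv (h.solvesOn y t) ht
  rw [h.map_zero, h.map_zero] at this
  rwa [mul_comm, Real.coe_toNNReal _ (Real.exp_pos _).le]

theorem IsSemiflow.map_add (hv : LipschitzWith K v) (h : IsSemiflow v Ψ) {s t : ℝ}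
    (hs : 0 ≤ s) (ht : 0 ≤ t) (x : E) : Ψ s (Ψ t x) = Ψ (t + s) x := by
  have h1 : SolvesOn v (fun r => Ψ (t + r) x) s := fun r hr => by
    have h2 : HasDerivWithinAt (fun r : ℝ => t + r) 1 (Icc 0 s) r := by
      simpa using (hasDerivWithinAt_id r (Icc 0 s)).const_add t
    have hm : MapsTo (fun r : ℝ => t + r) (Icc 0 s) (Ici 0) := fun r hr => add_nonneg ht hr.1
    simpa [Function.comp_def] using (h.hasDerivWithinAt x (t + r) (hm hr)).scomp r h2 hm
  simpa using h.eq_of_solvesOn hv h1 (t := s) ⟨hs, le_rfl⟩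

theorem IsSemiflow.continuousOn (hv : LipschitzWith K v) (h : IsSemiflow v Ψ) :
    ContinuousOn (Function.uncurry Ψ) (Ici 0 ×ˢ univ) := by
  rintro ⟨t, x⟩ ⟨ht, -⟩
  have h1 : ContinuousOn (Function.uncurry Ψ) (Icc 0 (t + 1) ×ˢ univ) :=
    continuousOn_prod_of_continuousOn_lipschitzOnWith' _ (Real.exp (K * (t + 1))).toNNReal
      (fun r hr => (h.lipschitzWith hv hr.1 hr.2).lipschitzOnWith)
      (fun y _ => (h.solvesOn y _).continuousOn)
  refine (h1 (t, x) ⟨⟨ht, by linarith⟩, mem_univ _⟩).mono_of_mem_nhdsWithin ?_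
  rw [nhdsWithin_prod_eq]
  refine prod_mem_prod ?_ univ_mem
  rw [← Ici_inter_Iic]
  exact inter_mem self_mem_nhdsWithin (mem_nhdsWithin_of_mem_nhds (Iic_mem_nhds (by linarith)))

end GlobalODE

/-! ### Cut-offs, and localisation of locally Lipschitz equations -/

section Cutoff

variable {E : Type*} [NormedAddCommGroup E] [NormedSpace ℝ E]

/-- Nothing is known about `f` off `S`. If one point lies outside `S`, then `χ` vanishes there and
is at most `L * dist` at the other point, which replaces the product rule. -/
theorem lipschitzWith_cutoff_smul {χ : E → ℝ} {f : E → E} {S : Set E} {L C M : ℝ≥0}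
    (hχ : LipschitzWith L χ) (hχ1 : ∀ x, |χ x| ≤ 1) (hχS : ∀ x, x ∉ S → χ x = 0)
    (hf : LipschitzOnWith C f S) (hM : ∀ x ∈ S, ‖f x‖ ≤ M) :
    LipschitzWith (C + L * M) fun x => χ x • f x := by
  have aux : ∀ x y, x ∉ S → dist (χ x • f x) (χ y • f y) ≤ L * dist x y * M := fun x y hx => by
    by_cases hy : y ∈ S
    · have h1 := hχ.dist_le_mul x y
      rw [hχS x hx, Real.dist_eq, zero_sub, abs_neg] at h1
      rw [hχS x hx, zero_smul, dist_zero_left, norm_smul, Real.norm_eq_abs]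
      exact mul_le_mul h1 (hM y hy) (norm_nonneg _) (by positivity)
    · rw [hχS x hx, hχS y hy, zero_smul, zero_smul, dist_self]; positivity
  refine LipschitzWith.of_dist_le_mul fun x y => ?_
  push_cast
  have hd := dist_nonneg (x := x) (y := y)
  have hC := C.coe_nonneg
  by_cases hx : x ∈ S
  · by_cases hy : y ∈ S
    · have h1 : χ x • f x - χ y • f y = χ x • (f x - f y) + (χ x - χ y) • f y := by
        rw [smul_sub, sub_smul]; abel
      rw [dist_eq_norm (χ x • f x), h1]
      refine (norm_add_le _ _).trans ?_
      rw [norm_smul, norm_smul, add_mul]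
      have h2 := hf.dist_le_mul x hx y hy
      have h3 := hχ.dist_le_mul x y
      rw [dist_eq_norm (f x)] at h2
      rw [dist_eq_norm (χ x)] at h3
      refine add_le_add ?_ ?_
      · calc ‖χ x‖ * ‖f x - f y‖ ≤ 1 * (C * dist x y) :=
            mul_le_mul (hχ1 x) h2 (norm_nonneg _) zero_le_one
          _ = C * dist x y := one_mul _
      · calc ‖χ x - χ y‖ * ‖f y‖ ≤ (L * dist x y) * M :=
            mul_le_mul h3 (hM y hy) (norm_nonneg _) (by positivity)
          _ = L * M * dist x y := by ring
    · rw [dist_comm]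
      refine (aux y x hy).trans ?_
      rw [dist_comm y x]
      nlinarith [mul_nonneg hC hd]
  · refine (aux x y hx).trans ?_
    nlinarith [mul_nonneg hC hd]

/-- A locally Lipschitz field on an open set can be cut off outside a compact set so as to become
globally Lipschitz and bounded. -/
theorem exists_cutoff [ProperSpace E] {X K : Set E} {f : E → E} (hX : IsOpen X)
    (hf : LocallyLipschitzOn X f) (hK : IsCompact K) (hKX : K ⊆ X) :
    ∃ χ : E → ℝ, Continuous χ ∧ (∀ x, 0 ≤ χ x) ∧ (∃ ε > 0, ∀ x ∈ Metric.cthickening ε K, χ x = 1) ∧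
      HasCompactSupport χ ∧ tsupport χ ⊆ X ∧ (∃ C, LipschitzWith C fun x => χ x • f x) ∧
      ∃ M : ℝ≥0, ∀ x, ‖χ x • f x‖ ≤ M := by
  obtain ⟨δ, hδ, hδX⟩ := hK.exists_cthickening_subset_open hX hKX
  set S := Metric.cthickening δ K with hS
  have hSc : IsCompact S := hK.cthickening
  have hδ2 : 0 < δ / 2 := half_pos hδ
  -- Two thickenings by `δ / 2`: `χ` is 1 on all of `A`, which leaves room for trajectories near
  -- those in `K`, and vanishes off `S ⊆ X`.
  set A := Metric.cthickening (δ / 2) K with hA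
  obtain ⟨C, hC⟩ := (hf.mono hδX).exists_lipschitzOnWith_of_compact hSc
  obtain ⟨M, hM⟩ := hSc.exists_bound_of_continuousOn (hf.continuousOn.mono hδX)
  have hM' : ∀ x ∈ S, ‖f x‖ ≤ M.toNNReal := fun x hx => (hM x hx).trans (Real.le_coe_toNNReal M)
  set χ : E → ℝ := fun x => (thickenedIndicator hδ2 A x : ℝ) with hχ
  have hAS : Metric.thickening (δ / 2) A ⊆ S := by
    refine (Metric.thickening_subset_cthickening _ _).trans
      ((Metric.cthickening_cthickening_subset hδ2.le hδ2.le K).trans ?_)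
    rw [add_halves]
  have hχS : ∀ x, x ∉ S → χ x = 0 := fun x hx => by
    simp only [hχ]
    rw [thickenedIndicator_zero hδ2 A fun h => hx (hAS h)]; rfl
  have hχ1 : ∀ x, χ x ≤ 1 := fun x => by exact_mod_cast thickenedIndicator_le_one hδ2 A x
  have hχ0 : ∀ x, 0 ≤ χ x := fun x => NNReal.coe_nonneg _
  have hsupp : tsupport χ ⊆ S :=
    closure_minimal (fun x hx => by by_contra h; exact hx (hχS x h)) hSc.isClosed
  have hlip : LipschitzWith (δ / 2).toNNReal⁻¹ χ := fun x y =>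
    lipschitzWith_thickenedIndicator hδ2 A x y
  refine ⟨χ, hlip.continuous, hχ0, ⟨δ / 2, hδ2, fun x hx => ?_⟩,
    hSc.of_isClosed_subset (isClosed_tsupport _) hsupp, hsupp.trans hδX, ⟨_,
    lipschitzWith_cutoff_smul hlip (fun x => abs_le.2 ⟨by linarith [hχ0 x], hχ1 x⟩) hχS hC hM'⟩,
    M.toNNReal, fun x => ?_⟩
  · simp only [hχ]
    rw [thickenedIndicator_one hδ2 A hx]; rfl
  · by_cases hx : x ∈ S
    · rw [norm_smul, Real.norm_eq_abs, abs_of_nonneg (hχ0 x)]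
      exact (mul_le_of_le_one_left (norm_nonneg _) (hχ1 x)).trans (hM' x hx)
    · rw [hχS x hx, zero_smul, norm_zero]; positivity

/-- Uniqueness of solutions for a locally Lipschitz field. -/
theorem SolvesOn.eqOn_of_locallyLipschitzOn [ProperSpace E] {X : Set E} {f : E → E}
    (hX : IsOpen X) (hf : LocallyLipschitzOn X f) {γ γ' : ℝ → E} {T : ℝ}
    (h : SolvesOn f γ T) (h' : SolvesOn f γ' T) (hγ : ∀ t ∈ Icc 0 T, γ t ∈ X)
    (hγ' : ∀ t ∈ Icc 0 T, γ' t ∈ X) (h0 : γ 0 = γ' 0) : EqOn γ γ' (Icc 0 T) := by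
  have hK : IsCompact (image γ (Icc 0 T) ∪ image γ' (Icc 0 T)) :=
    (isCompact_Icc.image_of_continuousOn h.continuousOn).union
      (isCompact_Icc.image_of_continuousOn h'.continuousOn)
  obtain ⟨χ, -, -, ⟨ε, hε, h1⟩, -, -, ⟨C, hC⟩, -⟩ := exists_cutoff hX hf hK
    (union_subset (by rintro _ ⟨t, ht, rfl⟩; exact hγ t ht)
      (by rintro _ ⟨t, ht, rfl⟩; exact hγ' t ht))
  refine SolvesOn.eqOn hC (h.congr_field fun t ht => ?_) (h'.congr_field fun t ht => ?_) h0
  · rw [h1 _ (Metric.self_subset_cthickening _ (Or.inl ⟨t, ht, rfl⟩)), one_smul]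
  · rw [h1 _ (Metric.self_subset_cthickening _ (Or.inr ⟨t, ht, rfl⟩)), one_smul]

/-- Near a point whose solution stays in `X` up to time `T`, the solutions of a locally Lipschitz
equation agree with the semiflow of a globally Lipschitz one. -/
theorem exists_semiflow_eq [ProperSpace E] {X : Set E} {f : E → E}
    (hX : IsOpen X) (hf : LocallyLipschitzOn X f) {s : ℝ → E → E} {T : ℝ}
    (hs : ∀ x ∈ X, SolvesOn f (fun t => s t x) T) (hs0 : ∀ x ∈ X, s 0 x = x)
    (hsX : ∀ x ∈ X, ∀ t ∈ Icc 0 T, s t x ∈ X) {x₀ : E} (hx₀ : x₀ ∈ X) :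
    ∃ v : E → E, ∃ C, LipschitzWith C v ∧ ∃ Ψ, IsSemiflow v Ψ ∧
      ∀ᶠ x in 𝓝 x₀, x ∈ X ∧ ∀ t ∈ Icc 0 T, s t x = Ψ t x := by
  have hK : IsCompact ((fun t => s t x₀) '' Icc 0 T) :=
    isCompact_Icc.image_of_continuousOn (hs x₀ hx₀).continuousOn
  obtain ⟨χ, -, -, ⟨ε, hε, h1⟩, -, hχX, ⟨C, hC⟩, M, hM⟩ := exists_cutoff hX hf hK
    (by rintro _ ⟨t, ht, rfl⟩; exact hsX x₀ hx₀ t ht)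
  obtain ⟨Ψ, hΨ⟩ := exists_isSemiflow hC hM
  refine ⟨_, C, hC, Ψ, hΨ, ?_⟩
  have h0 : ∀ t ∈ Icc 0 T, Ψ t x₀ = s t x₀ := fun t ht => by
    have := hΨ.eq_of_solvesOn hC ((hs x₀ hx₀).congr_field (w := fun x => χ x • f x)
      fun t ht => by
        rw [h1 _ (Metric.self_subset_cthickening _ ⟨t, ht, rfl⟩), one_smul]) ht
    rwa [hs0 x₀ hx₀] at this
  -- By Gronwall a trajectory started at `x` stays within `dist x x₀ * exp (C * T)` of the one from
  -- `x₀`. Once this is below `ε`, it remains where `χ = 1`, hence in `X`, and solves the original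
  -- equation.
  have hlim : Tendsto (fun x => dist x x₀ * Real.exp (C * T)) (𝓝 x₀) (𝓝 0) :=
    Continuous.tendsto' (by fun_prop) _ _ (by simp)
  filter_upwards [hX.mem_nhds hx₀, hlim.eventually (gt_mem_nhds hε)] with x hx hxε
  refine ⟨hx, ?_⟩
  have hmem : ∀ t ∈ Icc 0 T, χ (Ψ t x) = 1 := fun t ht => by
    refine h1 _ (Metric.mem_cthickening_of_dist_le _ (s t x₀) _ _ ⟨t, ht, rfl⟩ ?_)
    rw [← h0 t ht]
    refine ((hΨ.dist_le hC ht.1 x x₀).trans ?_).trans hxε.le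
    gcongr
    exact ht.2
  refine SolvesOn.eqOn_of_locallyLipschitzOn hX hf (hs x hx)
    ((hΨ.solvesOn x T).congr_field fun t ht => ?_) (hsX x hx) (fun t ht => ?_) ?_
  · rw [hmem t ht, one_smul]
  · refine hχX (subset_tsupport _ ?_)
    rw [Function.mem_support, hmem t ht]; exact one_ne_zero
  · rw [hs0 x hx, hΨ.map_zero]

end Cutoff

/-- Volume and the Hausdorff measure of full dimension have the same null sets, and antilipschitz
maps control Hausdorff measures of preimages. No differentiability of the flow in the initial state
is needed. -/
theorem volume_preimage_eq_zero_of_antilipschitzWith {E : Type*} [NormedAddCommGroup E]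
    [InnerProductSpace ℝ E] [FiniteDimensional ℝ E] [MeasurableSpace E] [BorelSpace E]
    {C : ℝ≥0} {f : E → E} (hf : AntilipschitzWith C f) {N : Set E}
    (hN : volume N = 0) : volume (f ⁻¹' N) = 0 := by
  have h1 : (Measure.hausdorffMeasure (Module.finrank ℝ E) : Measure E) N = 0 :=
    Measure.absolutelyContinuous_isAddHaarMeasure _ _ hN
  refine Measure.absolutelyContinuous_isAddHaarMeasure volume
    (Measure.hausdorffMeasure (Module.finrank ℝ E) : Measure E) ?_
  refine le_antisymm ((hf.hausdorffMeasure_preimage_le (Nat.cast_nonneg _) N).trans ?_) zero_le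
  rw [h1, mul_zero]

/-! ### The flow of a policy and its Perron–Frobenius densities -/

namespace SafeControlProblem

variable {n m : ℕ} {P : SafeControlProblem n m}
  {u : EuclideanSpace ℝ (Fin n) → EuclideanSpace ℝ (Fin m)}

theorem IsPolicy.isTrajectory_flow (hu : P.IsPolicy u) {x : EuclideanSpace ℝ (Fin n)}
    (hx : x ∈ P.X) : P.IsTrajectory u x fun t => P.flow u t x := by
  have h := hu.exists_trajectory x hx
  have : (fun t => P.flow u t x) = h.choose := by
    funext t; rw [flow, dif_pos h]
  rw [this]
  exact h.choose_spec

theorem IsPolicy.flow_zero (hu : P.IsPolicy u) {x : EuclideanSpace ℝ (Fin n)} (hx : x ∈ P.X) :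
    P.flow u 0 x = x := (hu.isTrajectory_flow hx).1

theorem IsPolicy.flow_mem (hu : P.IsPolicy u) {x : EuclideanSpace ℝ (Fin n)} (hx : x ∈ P.X)
    {t : ℝ} (ht : 0 ≤ t) : P.flow u t x ∈ P.X := ((hu.isTrajectory_flow hx).2 t ht).1

theorem IsPolicy.hasDerivWithinAt_flow (hu : P.IsPolicy u) {x : EuclideanSpace ℝ (Fin n)}
    (hx : x ∈ P.X) {t : ℝ} (ht : 0 ≤ t) :
    HasDerivWithinAt (fun r => P.flow u r x) (P.field u (P.flow u t x)) (Ici 0) t :=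
  ((hu.isTrajectory_flow hx).2 t ht).2

theorem IsPolicy.solvesOn_flow (hu : P.IsPolicy u) {x : EuclideanSpace ℝ (Fin n)}
    (hx : x ∈ P.X) (T : ℝ) : SolvesOn (P.field u) (fun t => P.flow u t x) T :=
  fun _ ht => (hu.hasDerivWithinAt_flow hx ht.1).mono Icc_subset_Ici_self

theorem IsPolicy.exists_semiflow_eq (hu : P.IsPolicy u) {x₀ : EuclideanSpace ℝ (Fin n)}
    (hx₀ : x₀ ∈ P.X) (T : ℝ) :
    ∃ v, ∃ C, LipschitzWith C v ∧ ∃ Ψ, IsSemiflow v Ψ ∧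
      ∀ᶠ x in 𝓝 x₀, x ∈ P.X ∧ ∀ t ∈ Icc 0 T, P.flow u t x = Ψ t x :=
  _root_.exists_semiflow_eq P.isOpen_X hu.locallyLipschitz
    (fun _ hx => hu.solvesOn_flow hx T) (fun _ hx => hu.flow_zero hx)
    (fun _ hx _ ht => hu.flow_mem hx ht.1) hx₀

theorem IsPolicy.continuousOn_flow (hu : P.IsPolicy u) :
    ContinuousOn (Function.uncurry (P.flow u)) (Ici 0 ×ˢ P.X) := by
  rintro ⟨t, x⟩ ⟨ht, hx⟩
  obtain ⟨v, C, hv, Ψ, hΨ, h⟩ := hu.exists_semiflow_eq hx (t + 1)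
  have h1 : ContinuousWithinAt (Function.uncurry Ψ) (Ici 0 ×ˢ P.X) (t, x) :=
    (hΨ.continuousOn hv (t, x) ⟨ht, mem_univ _⟩).mono (prod_mono_right (subset_univ _))
  refine h1.congr_of_eventuallyEq ?_ (h.self_of_nhds.2 t ⟨ht, by linarith⟩)
  have h2 : ∀ᶠ q : ℝ × EuclideanSpace ℝ (Fin n) in 𝓝[Ici 0 ×ˢ P.X] (t, x), q.1 < t + 1 :=
    mem_nhdsWithin_of_mem_nhds ((isOpen_Iio.preimage continuous_fst).mem_nhds (by simp))
  have h3 : ∀ᶠ q : ℝ × EuclideanSpace ℝ (Fin n) in 𝓝[Ici 0 ×ˢ P.X] (t, x),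
      q.2 ∈ P.X ∧ ∀ t' ∈ Icc 0 (t + 1), P.flow u t' q.2 = Ψ t' q.2 :=
    mem_nhdsWithin_of_mem_nhds (continuous_snd.continuousAt.eventually h)
  filter_upwards [h2, h3, self_mem_nhdsWithin] with q hq2 hq3 hq
  exact hq3.2 q.1 ⟨hq.1, hq2.le⟩

/-- Being null is a local property, and near each point the flow agrees with an antilipschitz map.
-/
theorem IsPolicy.volume_preimage_flow (hu : P.IsPolicy u) {t : ℝ} (ht : 0 ≤ t)
    {N : Set (EuclideanSpace ℝ (Fin n))} (hN : volume N = 0) :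
    volume {x ∈ P.X | P.flow u t x ∈ N} = 0 := by
  refine measure_null_of_locally_null _ fun x hx => ?_
  obtain ⟨v, C, hv, Ψ, hΨ, h⟩ := hu.exists_semiflow_eq hx.1 t
  refine ⟨{x ∈ P.X | P.flow u t x ∈ N} ∩ {y | y ∈ P.X ∧ ∀ t' ∈ Icc 0 t, P.flow u t' y = Ψ t' y},
    inter_mem self_mem_nhdsWithin (mem_nhdsWithin_of_mem_nhds h), ?_⟩
  refine measure_mono_null ?_
    (volume_preimage_eq_zero_of_antilipschitzWith (hΨ.antilipschitzWith hv ht) hN)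
  rintro y ⟨hy1, hy2⟩
  rw [mem_preimage, ← hy2.2 t ⟨ht, le_rfl⟩]
  exact hy1.2

open Classical in
/-- The flow, extended by the identity to negative times and to states outside `X`. -/
def extFlow (P : SafeControlProblem n m)
    (u : EuclideanSpace ℝ (Fin n) → EuclideanSpace ℝ (Fin m)) :
    ℝ × EuclideanSpace ℝ (Fin n) → EuclideanSpace ℝ (Fin n) :=
  (Ici 0 ×ˢ P.X).piecewise (Function.uncurry (P.flow u)) Prod.snd

open Classical in
theorem extFlow_of_mem {t : ℝ} (ht : 0 ≤ t) {x : EuclideanSpace ℝ (Fin n)} (hx : x ∈ P.X) :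
    P.extFlow u (t, x) = P.flow u t x :=
  piecewise_eq_of_mem _ _ _ (show (t, x) ∈ Ici 0 ×ˢ P.X from ⟨ht, hx⟩)

open Classical in
theorem extFlow_of_neg {t : ℝ} (ht : t < 0) (x : EuclideanSpace ℝ (Fin n)) :
    P.extFlow u (t, x) = x :=
  piecewise_eq_of_notMem _ _ _ fun h => not_le.2 ht h.1

open Classical in
theorem IsPolicy.measurable_extFlow (hu : P.IsPolicy u) : Measurable (P.extFlow u) :=
  hu.continuousOn_flow.measurable_piecewise continuous_snd.continuousOn
    (measurableSet_Ici.prod P.isOpen_X.measurableSet)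

/-- The initial distribution, with density `h₀`. -/
def initLaw (P : SafeControlProblem n m) : Measure (EuclideanSpace ℝ (Fin n)) :=
  volume.withDensity fun x => ENNReal.ofReal (P.h₀ x)

instance : IsProbabilityMeasure P.initLaw :=
  ⟨by rw [initLaw, withDensity_apply _ MeasurableSet.univ, setLIntegral_univ, P.lintegral_h₀]⟩

theorem initLaw_absolutelyContinuous : P.initLaw ≪ volume := withDensity_absolutelyContinuous _ _

theorem ae_initLaw_mem_X₀ : ∀ᵐ x ∂P.initLaw, x ∈ P.X₀ := by
  rw [initLaw, ae_withDensity_iff P.measurable_h₀.ennreal_ofReal]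
  filter_upwards with x hx
  by_contra h
  exact hx (by rw [P.h₀_eq_zero x h, ENNReal.ofReal_zero])

theorem ae_initLaw_mem_X : ∀ᵐ x ∂P.initLaw, x ∈ P.X :=
  ae_initLaw_mem_X₀.mono fun _ hx => P.X₀_subset hx

theorem setLIntegral_mul_h₀ (F : EuclideanSpace ℝ (Fin n) → ℝ≥0∞) :
    ∫⁻ x in P.X, F x * ENNReal.ofReal (P.h₀ x) = ∫⁻ x, F x ∂P.initLaw := by
  rw [initLaw, lintegral_withDensity_eq_lintegral_mul_non_measurable _ P.measurable_h₀.ennreal_ofReal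
    (.of_forall fun _ => ENNReal.ofReal_lt_top), ← lintegral_indicator P.isOpen_X.measurableSet]
  refine lintegral_congr fun x => ?_
  by_cases hx : x ∈ P.X
  · simp [hx, mul_comm]
  · simp [hx, P.h₀_eq_zero x fun h => hx (P.X₀_subset h)]

theorem setIntegral_mul_h₀ (F : EuclideanSpace ℝ (Fin n) → ℝ) {S : Set (EuclideanSpace ℝ (Fin n))}
    (hS : ∀ x ∈ P.X₀, x ∉ S → F x = 0) :
    ∫ x in S, F x * P.h₀ x = ∫ x, F x ∂P.initLaw := by
  rw [initLaw, integral_withDensity_eq_integral_toReal_smul P.measurable_h₀.ennreal_ofReal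
    (.of_forall fun _ => ENNReal.ofReal_lt_top), setIntegral_eq_integral_of_forall_compl_eq_zero]
  · refine integral_congr_ae (.of_forall fun x => ?_)
    simp [ENNReal.toReal_ofReal (P.h₀_nonneg x), mul_comm]
  · intro x hx
    by_cases h : x ∈ P.X₀
    · rw [hS x h hx, zero_mul]
    · rw [P.h₀_eq_zero x h, mul_zero]

theorem initLaw_setOf_flow_mem (hu : P.IsPolicy u) {t : ℝ} (ht : 0 ≤ t)
    {A : Set (EuclideanSpace ℝ (Fin n))} (hA : MeasurableSet A) :
    ∫⁻ x in {x ∈ P.X | P.flow u t x ∈ A}, ENNReal.ofReal (P.h₀ x) =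
      P.initLaw.map (fun x => P.extFlow u (t, x)) A := by
  have hm : Measurable fun x => P.extFlow u (t, x) :=
    hu.measurable_extFlow.comp measurable_prodMk_left
  have hset : {x ∈ P.X | P.flow u t x ∈ A} = P.X ∩ (fun x => P.extFlow u (t, x)) ⁻¹' A := by
    ext x
    simp only [mem_ofPred_eq, mem_inter_iff, mem_preimage]
    exact and_congr_right fun hx => by rw [extFlow_of_mem ht hx]
  rw [Measure.map_apply hm hA, hset,
    ← withDensity_apply _ (P.isOpen_X.measurableSet.inter (hm hA))]
  refine measure_congr ?_
  filter_upwards [P.ae_initLaw_mem_X] with x hx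
  exact propext ⟨fun h => h.2, fun h => ⟨hx, h⟩⟩

theorem IsPolicy.map_extFlow_absolutelyContinuous (hu : P.IsPolicy u) (t : ℝ) :
    P.initLaw.map (fun x => P.extFlow u (t, x)) ≪ volume := by
  have hm : Measurable fun x => P.extFlow u (t, x) :=
    hu.measurable_extFlow.comp measurable_prodMk_left
  refine Measure.AbsolutelyContinuous.mk fun N hNm hN => ?_
  rcases le_or_gt 0 t with ht | ht
  · rw [← initLaw_setOf_flow_mem hu ht hNm]
    exact setLIntegral_measure_zero _ _ (hu.volume_preimage_flow ht hN)
  · rw [Measure.map_apply hm hNm]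
    refine initLaw_absolutelyContinuous ?_
    simpa [extFlow_of_neg ht] using hN

/-- The distribution at time `t` of the closed-loop system, as a Markov kernel in `t`. -/
def flowKernel (hu : P.IsPolicy u) : ProbabilityTheory.Kernel ℝ (EuclideanSpace ℝ (Fin n)) where
  toFun t := P.initLaw.map (fun x => P.extFlow u (t, x))
  measurable' := by
    refine Measure.measurable_of_measurable_coe _ fun s hs => ?_
    have : (fun t => P.initLaw.map (fun x => P.extFlow u (t, x)) s) =
        fun t => P.initLaw (Prod.mk t ⁻¹' (P.extFlow u ⁻¹' s)) := by
      funext t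
      exact Measure.map_apply (hu.measurable_extFlow.comp measurable_prodMk_left) hs
    rw [this]
    exact measurable_measure_prodMk_left (hu.measurable_extFlow hs)

instance (hu : P.IsPolicy u) : ProbabilityTheory.IsMarkovKernel (flowKernel hu) :=
  ⟨fun _ => Measure.isProbabilityMeasure_map
    (hu.measurable_extFlow.comp measurable_prodMk_left).aemeasurable⟩

/-- Radon–Nikodym for kernels gives jointly measurable densities, here relative to a finite measure
equivalent to volume. The first factor converts them to densities relative to volume. -/
theorem IsPolicy.exists_isPerronFrobenius (hu : P.IsPolicy u) :
    ∃ p, P.IsPerronFrobenius u p := by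
  let η : ProbabilityTheory.Kernel ℝ (EuclideanSpace ℝ (Fin n)) :=
    ProbabilityTheory.Kernel.const ℝ (volume : Measure (EuclideanSpace ℝ (Fin n))).toFinite
  have hη : ∀ t, η t = (volume : Measure (EuclideanSpace ℝ (Fin n))).toFinite := fun _ => rfl
  have hm := ProbabilityTheory.Kernel.measurable_rnDeriv (flowKernel hu) η
  refine ⟨fun t x => (volume : Measure (EuclideanSpace ℝ (Fin n))).toFinite.rnDeriv volume x *
    (flowKernel hu).rnDeriv η t x, ?_, fun t ht A hA _ => ?_⟩
  · exact ((Measure.measurable_rnDeriv _ _).comp measurable_snd).mul hm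
  · have hmt : Measurable ((flowKernel hu).rnDeriv η t) := hm.comp measurable_prodMk_left
    beta_reduce
    rw [setLIntegral_rnDeriv_mul (toFinite_absolutelyContinuous _) hmt.aemeasurable hA, ← hη t,
      ProbabilityTheory.Kernel.setLIntegral_rnDeriv _ hA, initLaw_setOf_flow_mem hu ht hA]
    · rfl
    · exact (hu.map_extFlow_absolutelyContinuous t).trans (absolutelyContinuous_toFinite _)

end SafeControlProblem

/-! ### The occupancy identity, uniqueness and safety -/

namespace SafeControlProblem

variable {n m : ℕ} {P : SafeControlProblem n m}
  {u : EuclideanSpace ℝ (Fin n) → EuclideanSpace ℝ (Fin m)}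
  {ρ : EuclideanSpace ℝ (Fin n) → ℝ≥0∞}

theorem IsOccupancyDensity.measurable (hρ : P.IsOccupancyDensity u ρ) : Measurable ρ := by
  obtain ⟨p, hp, h⟩ := hρ
  have : ρ = fun x => ∫⁻ t in Ici (0 : ℝ), p t x := funext h
  rw [this]
  exact hp.1.lintegral_prod_left

theorem IsPerronFrobenius.setLIntegral_mul (hu : P.IsPolicy u)
    {p : ℝ → EuclideanSpace ℝ (Fin n) → ℝ≥0∞} (hp : P.IsPerronFrobenius u p) {t : ℝ}
    (ht : 0 ≤ t) {g : EuclideanSpace ℝ (Fin n) → ℝ≥0∞} (hg : Measurable g) :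
    ∫⁻ x in P.X, g x * p t x = ∫⁻ x, g (P.extFlow u (t, x)) ∂P.initLaw := by
  have hXm := P.isOpen_X.measurableSet
  have hm : Measurable fun x => P.extFlow u (t, x) :=
    hu.measurable_extFlow.comp measurable_prodMk_left
  have hpm : Measurable (p t) := hp.1.comp measurable_prodMk_left
  have key : (volume.restrict P.X).withDensity (p t) =
      P.initLaw.map (fun x => P.extFlow u (t, x)) := by
    ext A hA
    rw [withDensity_apply _ hA, Measure.restrict_restrict hA,
      -- Trajectories from `X` stay in `X`, so intersecting the target event with `X` changes
      -- nothing.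
      ← hp.2 t ht (A ∩ P.X) (hA.inter hXm) inter_subset_right, ← initLaw_setOf_flow_mem hu ht hA]
    congr 2
    ext x
    exact and_congr_right fun hx => ⟨fun h => h.1, fun h => ⟨h, hu.flow_mem hx ht⟩⟩
  rw [← lintegral_map hg hm, ← key, lintegral_withDensity_eq_lintegral_mul _ hpm hg]
  simp only [Pi.mul_apply, mul_comm]

/-- The occupancy identity. -/
theorem IsOccupancyDensity.setLIntegral_mul (hu : P.IsPolicy u)
    (hρ : P.IsOccupancyDensity u ρ) {g : EuclideanSpace ℝ (Fin n) → ℝ≥0∞} (hg : Measurable g) :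
    ∫⁻ x in P.X, g x * ρ x = ∫⁻ x, (∫⁻ t in Ici (0 : ℝ), g (P.flow u t x)) ∂P.initLaw := by
  obtain ⟨p, hp, h⟩ := hρ
  have hgp : Measurable fun q : EuclideanSpace ℝ (Fin n) × ℝ => g q.1 * p q.2 q.1 :=
    (hg.comp measurable_fst).mul (hp.1.comp measurable_swap)
  calc ∫⁻ x in P.X, g x * ρ x = ∫⁻ x in P.X, ∫⁻ t in Ici (0 : ℝ), g x * p t x :=
        lintegral_congr fun x => by
          rw [h]; exact (lintegral_const_mul _ (hp.1.comp measurable_prodMk_right)).symm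
    _ = ∫⁻ t in Ici (0 : ℝ), ∫⁻ x in P.X, g x * p t x := lintegral_lintegral_swap hgp.aemeasurable
    _ = ∫⁻ t in Ici (0 : ℝ), ∫⁻ x, g (P.extFlow u (t, x)) ∂P.initLaw :=
        setLIntegral_congr_fun measurableSet_Ici fun t ht => hp.setLIntegral_mul hu ht hg
    _ = ∫⁻ x, (∫⁻ t in Ici (0 : ℝ), g (P.extFlow u (t, x))) ∂P.initLaw :=
        lintegral_lintegral_swap (hg.comp hu.measurable_extFlow).aemeasurable
    _ = _ := by
        refine lintegral_congr_ae ?_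
        filter_upwards [P.ae_initLaw_mem_X] with x hx
        exact setLIntegral_congr_fun measurableSet_Ici fun t ht => by rw [extFlow_of_mem ht hx]

theorem IsOccupancyDensity.setLIntegral (hu : P.IsPolicy u)
    (hρ : P.IsOccupancyDensity u ρ) {A : Set (EuclideanSpace ℝ (Fin n))} (hA : MeasurableSet A)
    (hAX : A ⊆ P.X) : ∫⁻ x in A, ρ x = ∫⁻ x, P.timeIn u A x ∂P.initLaw := by
  have h := hρ.setLIntegral_mul hu (g := A.indicator 1) (measurable_one.indicator hA)
  rw [show (∫⁻ x, P.timeIn u A x ∂P.initLaw) =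
    ∫⁻ x, (∫⁻ t in Ici (0 : ℝ), A.indicator 1 (P.flow u t x)) ∂P.initLaw from rfl, ← h]
  have : ∀ x, A.indicator (1 : EuclideanSpace ℝ (Fin n) → ℝ≥0∞) x * ρ x = A.indicator ρ x := fun x => by
    by_cases hx : x ∈ A <;> simp [hx]
  simp_rw [this]
  rw [lintegral_indicator hA, Measure.restrict_restrict hA, inter_eq_left.2 hAX]

theorem IsPolicy.exists_isOccupancyDensity (hu : P.IsPolicy u) :
    ∃ ρ, P.IsOccupancyDensity u ρ := by
  obtain ⟨p, hp⟩ := hu.exists_isPerronFrobenius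
  exact ⟨_, p, hp, fun _ => rfl⟩

theorem IsOccupancyDensity.ae_eq (hu : P.IsPolicy u) {ρ' : EuclideanSpace ℝ (Fin n) → ℝ≥0∞}
    (hρ : P.IsOccupancyDensity u ρ) (hρ' : P.IsOccupancyDensity u ρ') :
    ρ =ᵐ[volume.restrict P.X] ρ' := by
  refine ae_eq_of_forall_setLIntegral_eq_of_sigmaFinite hρ.measurable hρ'.measurable
    fun s hs _ => ?_
  rw [Measure.restrict_restrict hs,
    hρ.setLIntegral hu (hs.inter P.isOpen_X.measurableSet) inter_subset_right,
    hρ'.setLIntegral hu (hs.inter P.isOpen_X.measurableSet) inter_subset_right]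

theorem IsPolicy.aemeasurable_lintegral_flow (hu : P.IsPolicy u)
    {g : EuclideanSpace ℝ (Fin n) → ℝ≥0∞} (hg : Measurable g) :
    AEMeasurable (fun x => ∫⁻ t in Ici (0 : ℝ), g (P.flow u t x)) P.initLaw := by
  refine ⟨fun x => ∫⁻ t in Ici (0 : ℝ), g (P.extFlow u (t, x)), ?_, ?_⟩
  · exact (hg.comp hu.measurable_extFlow).lintegral_prod_left'
  · filter_upwards [P.ae_initLaw_mem_X] with x hx
    exact setLIntegral_congr_fun measurableSet_Ici fun t ht => by rw [extFlow_of_mem ht hx]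

theorem IsOccupancyDensity.isSafeAE_iff (hu : P.IsPolicy u) (hρ : P.IsOccupancyDensity u ρ) :
    P.IsSafeAE u ↔ ∫⁻ x in P.Xu, ρ x = 0 := by
  rw [hρ.setLIntegral hu P.measurableSet_Xu P.Xu_subset]
  exact (lintegral_eq_zero_iff' (hu.aemeasurable_lintegral_flow
    (measurable_one.indicator P.measurableSet_Xu))).symm

theorem IsSafe.isSafeAE (h : P.IsSafe u) : P.IsSafeAE u :=
  P.ae_initLaw_mem_X₀.mono h

/-- One visit to the open set `X_u` persists, by joint continuity of the flow, for a short time and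
for all nearby initial states. These have positive `h₀`-mass, against almost everywhere safety. -/
theorem IsPolicy.isSafe_of_isSafeAE (hu : P.IsPolicy u) (hXu : IsOpen P.Xu)
    (hpos : ∀ x ∈ P.X₀, ∀ V ∈ 𝓝 x, 0 < ∫⁻ y in V, ENNReal.ofReal (P.h₀ y))
    (h : P.IsSafeAE u) : P.IsSafe u := by
  intro x hx
  by_contra hne
  have hxX := P.X₀_subset hx
  obtain ⟨t, ht, hmem⟩ : ∃ t, 0 ≤ t ∧ P.flow u t x ∈ P.Xu := by
    by_contra! hall
    refine hne ?_
    rw [timeIn, setLIntegral_congr_fun (g := fun _ => 0) measurableSet_Ici fun t ht => by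
      simp [hall t ht]]
    simp
  have hc := hu.continuousOn_flow (t, x) ⟨ht, hxX⟩
  have hev := hc.preimage_mem_nhdsWithin (hXu.mem_nhds hmem)
  rw [nhdsWithin_prod_eq, P.isOpen_X.nhdsWithin_eq hxX] at hev
  obtain ⟨I, hI, V, hV, hIV⟩ := mem_prod_iff.1 hev
  -- The time interval is taken to the right of `t`, which also serves when `t = 0`.
  obtain ⟨b, hb, hbI⟩ : ∃ b > t, Ico t b ⊆ I :=
    mem_nhdsGE_iff_exists_Ico_subset.1 (nhdsWithin_mono t (Ici_subset_Ici.2 ht) hI)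
  have hbad : V ∩ P.X ⊆ {y | ¬ P.timeIn u P.Xu y = 0} := by
    rintro y ⟨hy, -⟩ h0
    have h1 : (volume (Ico t b) : ℝ≥0∞) ≤ P.timeIn u P.Xu y := by
      calc volume (Ico t b) = ∫⁻ _ in Ico t b, 1 := by simp
        _ = ∫⁻ r in Ico t b, P.Xu.indicator 1 (P.flow u r y) := by
            refine setLIntegral_congr_fun measurableSet_Ico fun r hr => ?_
            have : P.flow u r y ∈ P.Xu := hIV (show (r, y) ∈ I ×ˢ V from ⟨hbI hr, hy⟩)
            simp [this]
        _ ≤ _ := lintegral_mono_set (Ico_subset_Ici_self.trans (Ici_subset_Ici.2 ht))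
    rw [h0, Real.volume_Ico] at h1
    exact absurd h1 (not_le.2 (ENNReal.ofReal_pos.2 (by linarith)))
  have hnull : P.initLaw (V ∩ P.X) = 0 := measure_mono_null hbad h
  obtain ⟨W, hW, hWo, hxW⟩ := mem_nhds_iff.1 (inter_mem hV (P.isOpen_X.mem_nhds hxX))
  have := hpos x hx W (hWo.mem_nhds hxW)
  rw [← withDensity_apply _ hWo.measurableSet] at this
  exact this.ne' (measure_mono_null hW hnull)

theorem IsOccupancyDensity.cost_eq (hu : P.IsPolicy u) (hρ : P.IsOccupancyDensity u ρ) :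
    P.cost u = P.occupancyCost u ρ := by
  rw [cost, setLIntegral_mul_h₀, occupancyCost]
  exact (hρ.setLIntegral_mul hu
    (P.measurable_l.comp (measurable_id.prodMk hu.measurable)).ennreal_ofReal).symm

/-- The occupancy identity for integrable observables of any sign. -/
theorem IsOccupancyDensity.setIntegral_mul (hu : P.IsPolicy u) (hρ : P.IsOccupancyDensity u ρ)
    {g : EuclideanSpace ℝ (Fin n) → ℝ} (hg : Measurable g)
    (hfin : ∫⁻ x, (∫⁻ t in Ici (0 : ℝ), ‖g (P.flow u t x)‖ₑ) ∂P.initLaw < ⊤) :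
    IntegrableOn (fun x => g x * (ρ x).toReal) P.X ∧
      ∫ x, (∫ t in Ici (0 : ℝ), g (P.flow u t x)) ∂P.initLaw = ∫ x in P.X, g x * (ρ x).toReal := by
  have hρm := hρ.measurable
  have hfin' : ∫⁻ x in P.X, ‖g x‖ₑ * ρ x < ⊤ := by rwa [hρ.setLIntegral_mul hu hg.enorm]
  -- `toReal` sends `⊤` to 0, but `ρ` is almost everywhere finite where `g ≠ 0`; elsewhere the
  -- product vanishes anyway.
  have hρtop : ∀ᵐ x ∂volume.restrict P.X, g x ≠ 0 → ρ x ≠ ⊤ := by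
    filter_upwards [ae_lt_top (hg.enorm.mul hρm) hfin'.ne] with x hx hgx htop
    simp [htop, hgx] at hx
  -- `k` will be the norm, the positive part and the negative part, which reduces the signed
  -- identity to the one in `ℝ≥0∞`.
  have hmul : ∀ k : ℝ → ℝ≥0∞, k 0 = 0 → (∀ a b, 0 ≤ b → k (a * b) = k a * ENNReal.ofReal b) →
      ∫⁻ x in P.X, k (g x * (ρ x).toReal) = ∫⁻ x in P.X, k (g x) * ρ x := fun k hk0 hk => by
    refine lintegral_congr_ae ?_
    filter_upwards [hρtop] with x hx
    by_cases h : g x = 0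
    · simp [h, hk0]
    · rw [hk _ _ ENNReal.toReal_nonneg, ENNReal.ofReal_toReal (hx h)]
  have hint : IntegrableOn (fun x => g x * (ρ x).toReal) P.X := by
    refine ⟨(hg.mul hρm.ennreal_toReal).aestronglyMeasurable, ?_⟩
    rw [HasFiniteIntegral, hmul (fun a => ‖a‖ₑ) enorm_zero fun a b hb => by
      rw [enorm_mul, Real.enorm_eq_ofReal hb]]
    exact hfin'
  have hΦ := hu.measurable_extFlow.comp
    (measurable_swap : Measurable (Prod.swap : EuclideanSpace ℝ (Fin n) × ℝ → _))
  have hprod : ∀ k : ℝ → ℝ≥0∞, Measurable k →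
      ∫⁻ q, k (g (P.extFlow u q.swap)) ∂P.initLaw.prod (volume.restrict (Ici (0 : ℝ))) =
        ∫⁻ x in P.X, k (g x) * ρ x := fun k hk => by
    have hkm := (hk.comp hg).comp hΦ
    refine Eq.trans ?_ (hρ.setLIntegral_mul hu (hk.comp hg)).symm
    refine (lintegral_prod _ hkm.aemeasurable).trans (lintegral_congr_ae ?_)
    filter_upwards [P.ae_initLaw_mem_X] with x hx
    exact setLIntegral_congr_fun measurableSet_Ici fun t ht => by simp [extFlow_of_mem ht hx]
  have hintΦ : Integrable (fun q => g (P.extFlow u q.swap))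
      (P.initLaw.prod (volume.restrict (Ici (0 : ℝ)))) := by
    refine ⟨(hg.comp hΦ).aestronglyMeasurable, ?_⟩
    rw [HasFiniteIntegral, hprod (fun a => ‖a‖ₑ) measurable_enorm]
    exact hfin'
  refine ⟨hint, ?_⟩
  have hleft : ∫ x, (∫ t in Ici (0 : ℝ), g (P.flow u t x)) ∂P.initLaw =
      ∫ q, g (P.extFlow u q.swap) ∂P.initLaw.prod (volume.restrict (Ici (0 : ℝ))) := by
    rw [integral_prod _ hintΦ]
    refine integral_congr_ae ?_
    filter_upwards [P.ae_initLaw_mem_X] with x hx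
    exact setIntegral_congr_fun measurableSet_Ici fun t ht => by simp [extFlow_of_mem ht hx]
  rw [hleft, integral_eq_lintegral_pos_part_sub_lintegral_neg_part hintΦ,
    integral_eq_lintegral_pos_part_sub_lintegral_neg_part hint,
    hprod _ ENNReal.measurable_ofReal, hprod (fun a => ENNReal.ofReal (-a)) (by fun_prop),
    hmul _ ENNReal.ofReal_zero fun a b hb => ENNReal.ofReal_mul' hb,
    hmul (fun a => ENNReal.ofReal (-a)) (by simp) fun a b hb => by
      rw [← neg_mul, ENNReal.ofReal_mul' hb]]

end SafeControlProblem

theorem continuous_and_hasCompactSupport_of_continuousOn {E F : Type*} [TopologicalSpace E]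
    [T2Space E] [TopologicalSpace F] [Zero F] {V K : Set E} {k : E → F} (hV : IsOpen V)
    (hK : IsCompact K) (hKV : K ⊆ V) (hk : ContinuousOn k V) (h0 : ∀ x, x ∉ K → k x = 0) :
    Continuous k ∧ HasCompactSupport k := by
  have hs : tsupport k ⊆ K :=
    closure_minimal (fun x hx => by by_contra h; exact hx (h0 x h)) hK.isClosed
  exact ⟨hk.continuous_of_tsupport_subset hV (hs.trans hKV),
    hK.of_isClosed_subset (isClosed_tsupport _) hs⟩

/-! ### Integration by parts for the classical divergence -/

section Divergence

variable {n : ℕ} {V : Set (EuclideanSpace ℝ (Fin n))}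
  {w : EuclideanSpace ℝ (Fin n) → EuclideanSpace ℝ (Fin n)}

theorem continuousOn_divergence (hV : IsOpen V) (hw : ContDiffOn ℝ 1 w V) :
    ContinuousOn (divergence w) V := by
  have h := hw.continuousOn_fderiv_of_isOpen hV le_rfl
  refine continuousOn_finsetSum _ fun i _ => ?_
  exact (EuclideanSpace.proj (𝕜 := ℝ) i).continuous.comp_continuousOn
    (h.clm_apply continuousOn_const)

/-- Integration by parts against a compactly supported function. -/
theorem integral_mul_divergence (hV : IsOpen V) (hw : ContDiffOn ℝ 1 w V)
    {φ : EuclideanSpace ℝ (Fin n) → ℝ} (hφ : ContDiff ℝ 1 φ) (hφc : HasCompactSupport φ)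
    (hφV : tsupport φ ⊆ V) :
    ∫ x, φ x * divergence w x = -∫ x, fderiv ℝ φ x (w x) := by
  have hdw : ∀ x ∈ V, DifferentiableAt ℝ w x := fun x hx =>
    (hw.differentiableOn one_ne_zero).differentiableAt (hV.mem_nhds hx)
  have hφ' : Continuous (fderiv ℝ φ) := hφ.continuous_fderiv one_ne_zero
  have hint : ∀ k : EuclideanSpace ℝ (Fin n) → ℝ, ContinuousOn k V →
      (∀ x, x ∉ tsupport φ → k x = 0) → Integrable k := fun k hk h0 => by
    obtain ⟨h1, h2⟩ := continuous_and_hasCompactSupport_of_continuousOn hV hφc hφV hk h0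
    exact h1.integrable_of_hasCompactSupport h2
  have hwi : ∀ i, ContinuousOn (fun x => w x i) V := fun i =>
    (EuclideanSpace.proj (𝕜 := ℝ) i).continuous.comp_continuousOn hw.continuousOn
  have hdwi : ∀ i, ContinuousOn (fun x => fderiv ℝ w x (EuclideanSpace.single i 1) i) V := fun i =>
    (EuclideanSpace.proj (𝕜 := ℝ) i).continuous.comp_continuousOn
      ((hw.continuousOn_fderiv_of_isOpen hV le_rfl).clm_apply continuousOn_const)
  have hcoord : ∀ i, ∀ x ∈ V, fderiv ℝ (fun y => w y i) x =
      (EuclideanSpace.proj (𝕜 := ℝ) i).comp (fderiv ℝ w x) := fun i x hx =>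
    ((EuclideanSpace.proj (𝕜 := ℝ) i).hasFDerivAt.comp x (hdw x hx).hasFDerivAt).fderiv
  have hzero : ∀ x, x ∉ tsupport φ → φ x = 0 := fun x hx => image_eq_zero_of_notMem_tsupport hx
  -- Off `V` the field `w` need not be differentiable and the two derivatives may differ, but there
  -- `φ` is zero.
  have hmul : ∀ i x, φ x * fderiv ℝ (fun y => w y i) x (EuclideanSpace.single i 1) =
      φ x * fderiv ℝ w x (EuclideanSpace.single i 1) i := fun i x => by
    by_cases hx : x ∈ tsupport φ
    · rw [hcoord i x (hφV hx)]; rfl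
    · rw [hzero x hx, zero_mul, zero_mul]
  have hi1 : ∀ i, Integrable fun x => φ x * fderiv ℝ w x (EuclideanSpace.single i 1) i := fun i =>
    hint _ (hφ.continuous.continuousOn.mul (hdwi i)) fun x hx => by rw [hzero x hx, zero_mul]
  have hi2 : ∀ i, Integrable fun x => fderiv ℝ φ x (EuclideanSpace.single i 1) * w x i := fun i =>
    hint _ ((hφ'.clm_apply continuous_const).continuousOn.mul (hwi i)) fun x hx => by
      rw [fderiv_of_notMem_tsupport ℝ hx]; simp
  have hi3 : ∀ i, Integrable fun x => φ x * w x i := fun i =>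
    hint _ (hφ.continuous.continuousOn.mul (hwi i)) fun x hx => by rw [hzero x hx, zero_mul]
  have hparts : ∀ i, ∫ x, φ x * fderiv ℝ w x (EuclideanSpace.single i 1) i =
      -∫ x, fderiv ℝ φ x (EuclideanSpace.single i 1) * w x i := fun i => by
    have := integral_mul_fderiv_eq_neg_fderiv_mul_of_integrable (μ := volume) (f := φ)
      (g := fun y => w y i) (v := EuclideanSpace.single i 1) (hi2 i)
      (by simpa only [hmul] using hi1 i) (hi3 i)
      (fun x _ => hφ.differentiable one_ne_zero x) fun x hx =>
        ((EuclideanSpace.proj (𝕜 := ℝ) i).hasFDerivAt.comp x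
          (hdw x (hφV hx)).hasFDerivAt).differentiableAt
    simpa only [hmul] using this
  have hsum : ∀ x, fderiv ℝ φ x (w x) =
      ∑ i, fderiv ℝ φ x (EuclideanSpace.single i 1) * w x i := fun x => by
    conv_lhs => rw [← (EuclideanSpace.basisFun (Fin n) ℝ).sum_repr (w x)]
    simp [mul_comm]
  simp_rw [hsum, divergence, Finset.mul_sum]
  rw [integral_finsetSum _ fun i _ => hi1 i, integral_finsetSum _ fun i _ => hi2 i,
    ← Finset.sum_neg_distrib]
  exact Finset.sum_congr rfl fun i _ => hparts i

end Divergence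

/-! ### The Liouville equation for the occupancy density -/

namespace SafeControlProblem

variable {n m : ℕ} {P : SafeControlProblem n m}
  {u : EuclideanSpace ℝ (Fin n) → EuclideanSpace ℝ (Fin m)}
  {ρ : EuclideanSpace ℝ (Fin n) → ℝ≥0∞}

/-- The integrand is the time derivative of `φ` along the trajectory, and `φ` vanishes there from
time `T` on. -/
theorem IsPolicy.integral_fderiv_flow (hu : P.IsPolicy u) {φ : EuclideanSpace ℝ (Fin n) → ℝ}
    (hφ : Differentiable ℝ φ) (hc : Continuous fun x => fderiv ℝ φ x (P.field u x))
    {x : EuclideanSpace ℝ (Fin n)} (hx : x ∈ P.X) {T : ℝ} (hT : 0 ≤ T)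
    (h0 : ∀ t, T ≤ t → P.flow u t x ∉ tsupport φ) :
    ∫ t in Ici (0 : ℝ), fderiv ℝ φ (P.flow u t x) (P.field u (P.flow u t x)) = -φ x := by
  have hcont : ContinuousOn (fun t => P.flow u t x) (Icc 0 T) :=
    (hu.solvesOn_flow hx T).continuousOn
  have h1 : ∫ t in Ici (0 : ℝ), fderiv ℝ φ (P.flow u t x) (P.field u (P.flow u t x)) =
      ∫ t in Ioc 0 T, fderiv ℝ φ (P.flow u t x) (P.field u (P.flow u t x)) := by
    rw [integral_Ici_eq_integral_Ioi]
    refine setIntegral_eq_of_subset_of_forall_sdiff_eq_zero measurableSet_Ioi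
      Ioc_subset_Ioi_self fun t ht => ?_
    have : T ≤ t := by
      by_contra! h
      exact ht.2 ⟨ht.1, h.le⟩
    rw [fderiv_of_notMem_tsupport ℝ (h0 t this)]; rfl
  rw [h1, ← intervalIntegral.integral_of_le hT,
    intervalIntegral.integral_eq_sub_of_hasDerivAt_of_le hT
      (f := fun t => φ (P.flow u t x))
      (f' := fun t => fderiv ℝ φ (P.flow u t x) (P.field u (P.flow u t x)))
      (hφ.continuous.comp_continuousOn hcont) (fun t ht => ?_)
      ((hc.comp_continuousOn hcont).intervalIntegrable_of_Icc hT),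
    image_eq_zero_of_notMem_tsupport (h0 T le_rfl), hu.flow_zero hx, zero_sub]
  exact (hφ _).hasFDerivAt.comp_hasDerivAt t
    ((hu.hasDerivWithinAt_flow hx ht.1.le).hasDerivAt (Ici_mem_nhds ht.1))

theorem IsPolicy.continuous_fderiv_field (hu : P.IsPolicy u)
    {φ : EuclideanSpace ℝ (Fin n) → ℝ} (hφ : ContDiff ℝ 1 φ) (hφc : HasCompactSupport φ)
    (hφX : tsupport φ ⊆ P.X) :
    Continuous (fun x => fderiv ℝ φ x (P.field u x)) ∧
      HasCompactSupport fun x => fderiv ℝ φ x (P.field u x) :=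
  continuous_and_hasCompactSupport_of_continuousOn P.isOpen_X hφc hφX
    ((hφ.continuous_fderiv one_ne_zero).continuousOn.clm_apply hu.locallyLipschitz.continuousOn)
    fun x hx => by rw [fderiv_of_notMem_tsupport ℝ hx]; rfl

/-- The occupancy identity is applied to `∇φ · F`. Finite occupancy of the compact support of `φ`
makes it integrable; being driven to `X_r` kills the boundary term at infinity. -/
theorem IsOccupancyDensity.solvesLiouville (hu : P.IsPolicy u) (hρ : P.IsOccupancyDensity u ρ)
    (hdrive : P.DrivesToTarget u) (hfin : P.HasFiniteOccupancy u) : P.SolvesLiouville u ρ := by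
  have hfin' : ∀ K, IsCompact K → K ⊆ P.X \ P.Xr → ∫⁻ x, P.timeIn u K x ∂P.initLaw < ⊤ :=
    fun K hK hKY => by rw [← setLIntegral_mul_h₀]; exact hfin K hK hKY
  refine ⟨fun K hK hKY => ?_, fun φ hφ hφc hφY => ?_⟩
  · rw [hρ.setLIntegral hu hK.measurableSet (hKY.trans sdiff_subset)]
    exact hfin' K hK hKY
  have hφ1 : ContDiff ℝ 1 φ := hφ.of_le (by exact_mod_cast le_top)
  obtain ⟨hc, hcs⟩ := hu.continuous_fderiv_field hφ1 hφc (hφY.trans sdiff_subset)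
  obtain ⟨C, hC⟩ := hcs.exists_bound_of_continuous hc
  have hbound : ∀ y, ‖fderiv ℝ φ y (P.field u y)‖ₑ ≤
      ENNReal.ofReal C * (tsupport φ).indicator 1 y := fun y => by
    by_cases hy : y ∈ tsupport φ
    · rw [indicator_of_mem hy, Pi.one_apply, mul_one, ← ofReal_norm]
      exact ENNReal.ofReal_le_ofReal (hC y)
    · rw [fderiv_of_notMem_tsupport ℝ hy]; simp
  obtain ⟨-, hid⟩ := hρ.setIntegral_mul hu hc.measurable (by
    calc ∫⁻ x, (∫⁻ t in Ici (0 : ℝ),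
          ‖fderiv ℝ φ (P.flow u t x) (P.field u (P.flow u t x))‖ₑ) ∂P.initLaw
        ≤ ∫⁻ x, ENNReal.ofReal C * P.timeIn u (tsupport φ) x ∂P.initLaw := by
          refine lintegral_mono fun x => ?_
          rw [timeIn, ← lintegral_const_mul' _ _ ENNReal.ofReal_ne_top]
          exact lintegral_mono fun t => hbound _
      _ = ENNReal.ofReal C * ∫⁻ x, P.timeIn u (tsupport φ) x ∂P.initLaw :=
          lintegral_const_mul' _ _ ENNReal.ofReal_ne_top
      _ < ⊤ := ENNReal.mul_lt_top ENNReal.ofReal_lt_top (hfin' _ hφc hφY))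
  rw [setIntegral_mul_h₀ φ fun x _ hx =>
      image_eq_zero_of_notMem_tsupport fun h => hx (hφY h),
    ← setIntegral_eq_of_subset_of_forall_sdiff_eq_zero P.isOpen_X.measurableSet
      (sdiff_subset : P.X \ P.Xr ⊆ P.X) (fun x hx => by
        rw [fderiv_of_notMem_tsupport ℝ fun h => hx.2 (hφY h)]; simp), ← hid, ← integral_neg]
  refine integral_congr_ae ?_
  filter_upwards [P.ae_initLaw_mem_X₀] with x hx
  obtain ⟨T, hT, hTr⟩ := hdrive x hx
  rw [hu.integral_fderiv_flow (hφ1.differentiable one_ne_zero) hc (P.X₀_subset hx) hT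
    fun t ht h => (hφY h).2 (hTr t ht), neg_neg]

/-- After integration by parts, the divergence minus `h₀` annihilates every test function supported
in `V`, so it vanishes almost everywhere; continuity of both sides removes the exceptional set. -/
theorem SolvesLiouville.divergence_eq (hL : P.SolvesLiouville u ρ)
    {V : Set (EuclideanSpace ℝ (Fin n))} (hV : IsOpen V) (hVY : V ⊆ P.X \ P.Xr)
    (hh : ContinuousOn P.h₀ V) {g : EuclideanSpace ℝ (Fin n) → ℝ}
    (hg : ∀ᵐ x ∂(volume.restrict V), g x = (ρ x).toReal)
    (hw : ContDiffOn ℝ 1 (fun x => g x • P.field u x) V) :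
    ∀ x ∈ V, divergence (fun y => g y • P.field u y) x = P.h₀ x := by
  have hdc := continuousOn_divergence hV hw
  set w := fun x => g x • P.field u x with hwdef
  refine Measure.eqOn_open_of_ae_eq (μ := volume) ?_ hV hdc hh
  have key : ∀ᵐ x, x ∈ V → divergence w x - P.h₀ x = 0 := by
    refine hV.ae_eq_zero_of_integral_contDiff_smul_eq_zero
      ((hdc.sub hh).locallyIntegrableOn hV.measurableSet) fun φ hφ hφc hφV => ?_
    have hφ1 : ContDiff ℝ 1 φ := hφ.of_le (by exact_mod_cast le_top)
    have hint : ∀ k : EuclideanSpace ℝ (Fin n) → ℝ, ContinuousOn k V →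
        Integrable fun x => φ x * k x := fun k hk => by
      obtain ⟨h1, h2⟩ := continuous_and_hasCompactSupport_of_continuousOn hV hφc hφV
        (hφ.continuous.continuousOn.mul hk)
        fun x hx => by rw [Pi.mul_apply, image_eq_zero_of_notMem_tsupport hx, zero_mul]
      exact h1.integrable_of_hasCompactSupport h2
    simp only [smul_eq_mul, mul_sub]
    rw [integral_sub (hint _ hdc) (hint _ hh), integral_mul_divergence hV hw hφ1 hφc hφV]
    have h1 := hL.2 φ hφ hφc (hφV.trans hVY)
    have h2 : ∫ x, φ x * P.h₀ x = ∫ x in P.X \ P.Xr, φ x * P.h₀ x :=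
      (setIntegral_eq_integral_of_forall_compl_eq_zero fun x hx => by
        rw [image_eq_zero_of_notMem_tsupport fun h => hx (hVY (hφV h)), zero_mul]).symm
    have h3 : ∫ x in P.X \ P.Xr, fderiv ℝ φ x (P.field u x) * (ρ x).toReal =
        ∫ x in V, fderiv ℝ φ x (P.field u x) * (ρ x).toReal :=
      setIntegral_eq_of_subset_of_forall_sdiff_eq_zero P.isOpen_diff.measurableSet hVY
        fun x hx => by rw [fderiv_of_notMem_tsupport ℝ fun h => hx.2 (hφV h)]; simp
    have h4 : ∫ x, fderiv ℝ φ x (w x) = ∫ x in V, fderiv ℝ φ x (w x) :=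
      (setIntegral_eq_integral_of_forall_compl_eq_zero fun x hx => by
        rw [fderiv_of_notMem_tsupport ℝ fun h => hx (hφV h)]; rfl).symm
    have h5 : ∫ x in V, fderiv ℝ φ x (w x) =
        ∫ x in V, fderiv ℝ φ x (P.field u x) * (ρ x).toReal := by
      refine integral_congr_ae ?_
      filter_upwards [hg] with x hx
      simp [hwdef, hx, mul_comm]
    rw [h2, ← h1, h3, h4, h5, sub_self]
  filter_upwards [ae_restrict_of_ae key, ae_restrict_mem hV.measurableSet] with x hx hxV
  exact sub_eq_zero.1 (hx hxV)

end SafeControlProblem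

/-! ### Mollification and Lipschitz test functions -/

section Mollify

variable {E : Type*} [NormedAddCommGroup E] [NormedSpace ℝ E] [FiniteDimensional ℝ E]
  [MeasurableSpace E] [BorelSpace E] {μ : Measure E} [μ.IsAddHaarMeasure]

/-- Moving the difference quotient from `b` to `φ` gives derivative bounds by the Lipschitz
constant, whatever the mollification scale. -/
theorem fderiv_convolution_eq_convolution_lineDeriv {b φ : E → ℝ} {C : ℝ≥0}
    (hb : ContDiff ℝ 1 b) (hbc : HasCompactSupport b) (hφ : LipschitzWith C φ) (x v : E) :
    fderiv ℝ (b ⋆[ContinuousLinearMap.lsmul ℝ ℝ, μ] φ) x v =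
      (b ⋆[ContinuousLinearMap.lsmul ℝ ℝ, μ] fun y => lineDeriv ℝ φ y v) x := by
  have hd : DifferentiableAt ℝ (b ⋆[ContinuousLinearMap.lsmul ℝ ℝ, μ] φ) x :=
    (hbc.contDiff_convolution_left _ hb hφ.continuous.locallyIntegrable).differentiable
      one_ne_zero x
  have hbx : Continuous fun y => b (x - y) :=
    hb.continuous.comp (continuous_const.sub continuous_id)
  have hbxc : HasCompactSupport fun y => b (x - y) :=
    hbc.comp_homeomorph (Homeomorph.subLeft x)
  have h1 := hd.hasFDerivAt.hasLineDerivAt v |>.tendsto_slope_zero_right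
  have h2 := hφ.integral_inv_smul_sub_mul_tendsto_integral_lineDeriv_mul
    (hbx.integrable_of_hasCompactSupport (μ := μ) hbxc) v
  rw [convolution_eq_swap]
  simp only [ContinuousLinearMap.lsmul_apply, smul_eq_mul]
  simp_rw [mul_comm (b _)]
  refine tendsto_nhds_unique h1 (h2.congr fun t => ?_)
  have hval : ∀ s : ℝ, (b ⋆[ContinuousLinearMap.lsmul ℝ ℝ, μ] φ) (x + s • v) =
      ∫ y, φ (y + s • v) * b (x - y) ∂μ := fun s => by
    rw [convolution_eq_swap, ← integral_add_right_eq_self _ (s • v)]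
    refine integral_congr_ae (.of_forall fun y => ?_)
    simp [mul_comm]
  have hint : ∀ s : ℝ, Integrable (fun y => φ (y + s • v) * b (x - y)) μ := fun s =>
    ((hφ.continuous.comp (continuous_add_const _)).mul hbx).integrable_of_hasCompactSupport
      hbxc.mul_left
  have h0 := hval 0
  have hi0 := hint 0
  simp only [zero_smul, add_zero] at h0 hi0
  rw [h0, hval t, ← integral_sub (hint t) hi0, smul_eq_mul, ← integral_const_mul]
  refine integral_congr_ae (.of_forall fun y => ?_)
  simp only [smul_eq_mul]
  ring

theorem norm_convolution_normed_le {b : ContDiffBump (0 : E)} {g : E → ℝ} {M : ℝ}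
    (hg : ∀ x, ‖g x‖ ≤ M) (x : E) :
    ‖(b.normed μ ⋆[ContinuousLinearMap.lsmul ℝ ℝ, μ] g) x‖ ≤ M := by
  have hint : Integrable (fun t => b.normed μ t * M) μ := b.integrable_normed.mul_const M
  calc ‖(b.normed μ ⋆[ContinuousLinearMap.lsmul ℝ ℝ, μ] g) x‖
      ≤ ∫ t, b.normed μ t * M ∂μ := by
        refine norm_integral_le_of_norm_le hint (.of_forall fun t => ?_)
        rw [ContinuousLinearMap.lsmul_apply, norm_smul, Real.norm_eq_abs,
          abs_of_nonneg (b.nonneg_normed t)]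
        exact mul_le_mul_of_nonneg_left (hg _) (b.nonneg_normed t)
    _ = M := by rw [integral_mul_const, b.integral_normed, one_mul]

/-- Smooth approximations of a compactly supported Lipschitz function, with supports in a given
neighbourhood and with uniformly bounded derivatives that converge almost everywhere. -/
theorem exists_smooth_approx {φ : E → ℝ} {C : ℝ≥0} (hφ : LipschitzWith C φ)
    (hφc : HasCompactSupport φ) {δ : ℝ} (hδ : 0 < δ) :
    ∃ ψ : ℕ → E → ℝ, (∀ k, ContDiff ℝ (⊤ : ℕ∞) (ψ k)) ∧
      (∀ k, tsupport (ψ k) ⊆ Metric.cthickening δ (tsupport φ)) ∧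
      (∀ k x v, ‖fderiv ℝ (ψ k) x v‖ ≤ C * ‖v‖) ∧
      (∃ M, ∀ k x, ‖ψ k x‖ ≤ M) ∧
      (∀ x, Tendsto (fun k => ψ k x) atTop (𝓝 (φ x))) ∧
      ∀ᵐ x ∂μ, ∀ v, Tendsto (fun k => fderiv ℝ (ψ k) x v) atTop (𝓝 (fderiv ℝ φ x v)) := by
  let b : ℕ → ContDiffBump (0 : E) := fun k =>
    -- The fixed ratio 2 of the radii is what the Lebesgue differentiation step below asks for.
    ⟨δ / (k + 2) / 2, δ / (k + 2), by positivity, half_lt_self (by positivity)⟩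
  have hbδ : ∀ k, (b k).rOut ≤ δ := fun k =>
    div_le_self hδ.le (by linarith [(Nat.cast_nonneg k : (0 : ℝ) ≤ k)])
  have hb0 : Tendsto (fun k => (b k).rOut) atTop (𝓝 0) := by
    have := (tendsto_const_div_atTop_nhds_zero_nat δ).comp (tendsto_add_atTop_nat 2)
    refine this.congr fun k => ?_
    simp [b]
  have hb2 : ∀ᶠ k in atTop, (b k).rOut ≤ 2 * (b k).rIn :=
    .of_forall fun k => by simp only [b]; linarith
  obtain ⟨M, hM⟩ := hφc.exists_bound_of_continuous hφ.continuous
  set ψ : ℕ → E → ℝ := fun k =>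
    (b k).normed μ ⋆[ContinuousLinearMap.lsmul ℝ ℝ, μ] φ with hψ
  have hfd : ∀ k x v, fderiv ℝ (ψ k) x v = ((b k).normed μ ⋆[ContinuousLinearMap.lsmul ℝ ℝ, μ]
      fun y => lineDeriv ℝ φ y v) x := fun k x v =>
    fderiv_convolution_eq_convolution_lineDeriv (b k).contDiff_normed
      (b k).hasCompactSupport_normed hφ x v
  refine ⟨ψ, fun k => ?_, fun k => ?_, fun k x v => ?_, ⟨M, fun k x => ?_⟩, fun x => ?_, ?_⟩
  · exact (b k).hasCompactSupport_normed.contDiff_convolution_left _ (b k).contDiff_normed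
      hφ.continuous.locallyIntegrable
  · refine closure_minimal ?_ Metric.isClosed_cthickening
    refine (support_convolution_subset _).trans ?_
    rintro _ ⟨y, hy, z, hz, rfl⟩
    rw [(b k).support_normed_eq, Metric.mem_ball, dist_zero_right] at hy
    refine Metric.mem_cthickening_of_dist_le _ z _ _ (subset_tsupport _ hz) ?_
    simpa using hy.le.trans (hbδ k)
  · rw [hfd]
    exact norm_convolution_normed_le (fun y => norm_lineDeriv_le_of_lipschitz ℝ hφ) x
  · exact norm_convolution_normed_le hM x
  · exact ContDiffBump.convolution_tendsto_right_of_continuous hb0 hφ.continuous x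
  -- Almost everywhere convergence is taken only in basis directions; linearity at points of
  -- differentiability gives every `v` off a single null set. This is needed since `v` will be the
  -- field at `x`.
  · have hbasis : ∀ i, ∀ᵐ x ∂μ, Tendsto (fun k => fderiv ℝ (ψ k) x (Module.finBasis ℝ E i)) atTop
        (𝓝 (lineDeriv ℝ φ x (Module.finBasis ℝ E i))) := fun i => by
      simp_rw [hfd]
      exact ContDiffBump.ae_convolution_tendsto_right_of_locallyIntegrable hb0 hb2
        (hφ.locallyIntegrable_lineDeriv _)
    filter_upwards [ae_all_iff.2 hbasis, hφ.ae_differentiableAt] with x hx hdiff v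
    have hlin : ∀ L : E →L[ℝ] ℝ, L v =
        ∑ i, (Module.finBasis ℝ E).repr v i * L (Module.finBasis ℝ E i) := fun L => by
      conv_lhs => rw [← (Module.finBasis ℝ E).sum_repr v, map_sum]
      simp only [map_smul, smul_eq_mul]
    rw [hlin (fderiv ℝ φ x)]
    refine Tendsto.congr (fun k => (hlin (fderiv ℝ (ψ k) x)).symm) ?_
    refine tendsto_finsetSum _ fun i _ => ?_
    rw [← hdiff.lineDeriv_eq_fderiv]
    exact (hx i).const_mul _

end Mollify

namespace SafeControlProblem

variable {n m : ℕ} {P : SafeControlProblem n m}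
  {u : EuclideanSpace ℝ (Fin n) → EuclideanSpace ℝ (Fin m)}
  {ρ : EuclideanSpace ℝ (Fin n) → ℝ≥0∞}

theorem SolvesLiouville.integrableOn_toReal (hρ : Measurable ρ) (hL : P.SolvesLiouville u ρ)
    {K : Set (EuclideanSpace ℝ (Fin n))} (hK : IsCompact K) (hKY : K ⊆ P.X \ P.Xr) :
    IntegrableOn (fun x => (ρ x).toReal) K :=
  integrable_toReal_of_lintegral_ne_top hρ.aemeasurable (hL.1 K hK hKY).ne

theorem integrable_h₀ : Integrable P.h₀ := by
  refine ⟨P.measurable_h₀.aestronglyMeasurable, ?_⟩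
  rw [hasFiniteIntegral_iff_ofReal (.of_forall P.h₀_nonneg), P.lintegral_h₀]
  exact ENNReal.one_lt_top

/-- The weak Liouville equation may be tested with Lipschitz functions. -/
theorem SolvesLiouville.of_lipschitzWith (hu : P.IsPolicy u) (hρ : Measurable ρ)
    (hL : P.SolvesLiouville u ρ) {φ : EuclideanSpace ℝ (Fin n) → ℝ} {C : ℝ≥0}
    (hφ : LipschitzWith C φ) (hφc : HasCompactSupport φ) (hφY : tsupport φ ⊆ P.X \ P.Xr) :
    -∫ x in P.X \ P.Xr, fderiv ℝ φ x (P.field u x) * (ρ x).toReal =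
      ∫ x in P.X \ P.Xr, φ x * P.h₀ x := by
  obtain ⟨δ, hδ, hδY⟩ := hφc.isCompact.exists_cthickening_subset_open P.isOpen_diff hφY
  set K := Metric.cthickening δ (tsupport φ) with hK
  have hKc : IsCompact K := hφc.isCompact.cthickening
  obtain ⟨ψ, hψ, hψK, hψd, ⟨M, hM⟩, hlim, hlimd⟩ := exists_smooth_approx (μ := volume) hφ hφc hδ
  have hψc : ∀ k, HasCompactSupport (ψ k) := fun k =>
    hKc.of_isClosed_subset (isClosed_tsupport _) (hψK k)
  obtain ⟨B, hB⟩ := hKc.exists_bound_of_continuousOn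
    (hu.locallyLipschitz.continuousOn.mono (hδY.trans sdiff_subset))
  have h1 : Tendsto (fun k => ∫ x in P.X \ P.Xr, fderiv ℝ (ψ k) x (P.field u x) * (ρ x).toReal)
      atTop (𝓝 (∫ x in P.X \ P.Xr, fderiv ℝ φ x (P.field u x) * (ρ x).toReal)) := by
    refine tendsto_integral_of_dominated_convergence
      -- All supports lie in the compact set `K`: `C` bounds the derivatives, `B` bounds the field
      -- on `K`, and `ρ` is integrable there.
      (K.indicator fun x => C * B * (ρ x).toReal) (fun k => ?_) ?_ (fun k => ?_) ?_
    · have hc := (hu.continuous_fderiv_field ((hψ k).of_le (by exact_mod_cast le_top)) (hψc k)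
        ((hψK k).trans (hδY.trans sdiff_subset))).1
      exact (hc.measurable.mul hρ.ennreal_toReal).aestronglyMeasurable
    · refine Integrable.restrict ?_
      rw [integrable_indicator_iff hKc.measurableSet]
      exact (hL.integrableOn_toReal hρ hKc hδY).const_mul _
    · refine .of_forall fun x => ?_
      by_cases hx : x ∈ K
      · rw [indicator_of_mem hx, norm_mul, Real.norm_of_nonneg ENNReal.toReal_nonneg]
        refine mul_le_mul_of_nonneg_right ((hψd k x _).trans ?_) ENNReal.toReal_nonneg
        exact mul_le_mul_of_nonneg_left (hB x hx) C.coe_nonneg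
      · rw [fderiv_of_notMem_tsupport ℝ fun h => hx (hψK k h), indicator_of_notMem hx]
        simp
    · filter_upwards [ae_restrict_of_ae hlimd] with x hx
      exact (hx _).mul_const _
  have h2 : Tendsto (fun k => ∫ x in P.X \ P.Xr, ψ k x * P.h₀ x)
      atTop (𝓝 (∫ x in P.X \ P.Xr, φ x * P.h₀ x)) := by
    refine tendsto_integral_of_dominated_convergence (fun x => M * P.h₀ x) (fun k => ?_)
      (P.integrable_h₀.const_mul M).restrict (fun k => .of_forall fun x => ?_)
      (.of_forall fun x => (hlim x).mul_const _)
    · exact ((hψ k).continuous.measurable.mul P.measurable_h₀).aestronglyMeasurable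
    · rw [norm_mul, Real.norm_of_nonneg (P.h₀_nonneg x)]
      exact mul_le_mul_of_nonneg_right (hM k x) (P.h₀_nonneg x)
  refine tendsto_nhds_unique (h1.neg.congr fun k => ?_) h2
  exact hL.2 (ψ k) (hψ k) (hψc k) ((hψK k).trans hδY)

end SafeControlProblem

/-! ### Time integrals along a semiflow, as test functions -/

section CutoffSemiflow

variable {E : Type*} [NormedAddCommGroup E] [NormedSpace ℝ E] {v : E → E} {C : ℝ≥0}
  {Ψ : ℝ → E → E}

/-- A semiflow is unconstrained at negative times; clamping them to 0 gives continuity on the whole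
product. -/
theorem IsSemiflow.continuous_max (hv : LipschitzWith C v) (h : IsSemiflow v Ψ) :
    Continuous fun q : ℝ × E => Ψ (max q.1 0) q.2 :=
  (h.continuousOn hv).comp_continuous (f := fun q : ℝ × E => (max q.1 0, q.2))
    (by fun_prop) fun q => ⟨mem_Ici.2 (le_max_right _ _), mem_univ _⟩

theorem IsSemiflow.eq_self_of_eq_zero (hv : LipschitzWith C v) (h : IsSemiflow v Ψ) {z : E}
    (hz : v z = 0) {t : ℝ} (ht : 0 ≤ t) : Ψ t z = z :=
  h.eq_of_solvesOn hv (γ := fun _ => z) (T := t)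
    (fun r _ => by rw [hz]; exact hasDerivWithinAt_const _ _ _) ⟨ht, le_rfl⟩

/-- The integral of an observable along the semiflow up to time `T`. -/
def flowIntegral (Ψ : ℝ → E → E) (ψ : E → ℝ) (T : ℝ) (x : E) : ℝ :=
  ∫ t in 0..T, ψ (Ψ (max t 0) x)

variable {ψ : E → ℝ} {D : ℝ≥0} {T : ℝ}

theorem IsSemiflow.continuous_observable (hv : LipschitzWith C v) (h : IsSemiflow v Ψ)
    (hψ : Continuous ψ) (x : E) : Continuous fun t => ψ (Ψ (max t 0) x) :=
  hψ.comp ((h.continuous_max hv).comp (Continuous.prodMk_left x))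

theorem IsSemiflow.lipschitzWith_flowIntegral (hv : LipschitzWith C v) (h : IsSemiflow v Ψ)
    (hψ : LipschitzWith D ψ) (hT : 0 ≤ T) :
    LipschitzWith (D * (Real.exp (C * T)).toNNReal * T.toNNReal) (flowIntegral Ψ ψ T) := by
  refine LipschitzWith.of_dist_le_mul fun x y => ?_
  rw [flowIntegral, flowIntegral, dist_eq_norm, ← intervalIntegral.integral_sub
    ((h.continuous_observable hv hψ.continuous x).intervalIntegrable _ _)
    ((h.continuous_observable hv hψ.continuous y).intervalIntegrable _ _)]
  refine (intervalIntegral.norm_integral_le_of_norm_le_const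
    (C := D * (Real.exp (C * T)).toNNReal * dist x y) fun t ht => ?_).trans_eq ?_
  · rw [uIoc_of_le hT] at ht
    rw [← dist_eq_norm, max_eq_left ht.1.le]
    have := (hψ.comp (h.lipschitzWith hv ht.1.le ht.2)).dist_le_mul x y
    simpa using this
  · rw [sub_zero, abs_of_nonneg hT]
    push_cast
    rw [Real.coe_toNNReal T hT]
    ring

/-- By the semigroup law, moving the starting point along the flow for time `t` shifts the window of
integration to `[t, t + T]`. Both sides are right derivatives at `t = 0`. -/
theorem IsSemiflow.fderiv_flowIntegral (hv : LipschitzWith C v) (h : IsSemiflow v Ψ)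
    (hψ : Continuous ψ) (hT : 0 ≤ T) {x : E} (hd : DifferentiableAt ℝ (flowIntegral Ψ ψ T) x) :
    fderiv ℝ (flowIntegral Ψ ψ T) x (v x) = ψ (Ψ T x) - ψ x := by
  set k : ℝ → ℝ := fun t => ψ (Ψ (max t 0) x) with hk
  have hkc : Continuous k := h.continuous_observable hv hψ x
  have hG : ∀ s, HasDerivAt (fun s => ∫ r in 0..s, k r) (k s) s := fun s =>
    (hkc.integral_hasStrictDerivAt 0 s).hasDerivAt
  have hright : HasDerivWithinAt
      (fun t => (∫ r in 0..t + T, k r) - ∫ r in 0..t, k r) (k T - k 0) (Ici 0) 0 := by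
    refine HasDerivAt.hasDerivWithinAt (HasDerivAt.fun_sub ?_ (hG 0))
    have := (hG (0 + T)).comp_add_const 0 T
    rwa [zero_add] at this
  have heq : ∀ t ∈ Ici (0 : ℝ), flowIntegral Ψ ψ T (Ψ t x) =
      (∫ r in 0..t + T, k r) - ∫ r in 0..t, k r := fun t ht => by
    rw [intervalIntegral.integral_interval_sub_left (hkc.intervalIntegrable _ _)
      (hkc.intervalIntegrable _ _), flowIntegral]
    have h1 : ∫ r in t..t + T, k r = ∫ r in 0..T, k (t + r) := by
      rw [intervalIntegral.integral_comp_add_left k t, add_zero]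
    rw [h1]
    refine intervalIntegral.integral_congr fun r hr => ?_
    rw [uIcc_of_le hT] at hr
    simp only [hk]
    rw [max_eq_left hr.1, max_eq_left (add_nonneg ht hr.1), h.map_add hv hr.1 ht]
  have hleft : HasDerivWithinAt (fun t => flowIntegral Ψ ψ T (Ψ t x))
      (fderiv ℝ (flowIntegral Ψ ψ T) x (v x)) (Ici 0) 0 := by
    have h1 := h.hasDerivWithinAt x 0 le_rfl
    rw [h.map_zero] at h1
    have h2 : HasFDerivAt (flowIntegral Ψ ψ T) (fderiv ℝ (flowIntegral Ψ ψ T) x) (Ψ 0 x) := by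
      rw [h.map_zero]; exact hd.hasFDerivAt
    exact h2.comp_hasDerivWithinAt 0 h1
  have := (uniqueDiffOn_Ici (0 : ℝ) 0 self_mem_Ici).eq_deriv _
    (hleft.congr (fun t ht => (heq t ht).symm) (heq 0 self_mem_Ici).symm) hright
  rw [this]
  simp [hk, hT, h.map_zero]

/-- Points outside `U` are stationary. By Gronwall a trajectory that comes within `δ` of such a
point by time `T` started near it, so points whose trajectory meets the support of `ψ` keep distance
`δ * exp (-(C * T))` from the complement of `U`. -/
theorem IsSemiflow.tsupport_flowIntegral_subset [ProperSpace E] (hv : LipschitzWith C v)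
    (h : IsSemiflow v Ψ) (hψc : HasCompactSupport ψ) (hT : 0 ≤ T) {U : Set E} (hU : IsOpen U)
    (hψU : tsupport ψ ⊆ U) (hvU : ∀ z, z ∉ U → v z = 0) :
    tsupport (flowIntegral Ψ ψ T) ⊆ U := by
  obtain ⟨δ, hδ, hδU⟩ := hψc.isCompact.exists_thickening_subset_open hU hψU
  have hball : ∀ x ∈ Function.support (flowIntegral Ψ ψ T),
      Metric.ball x (δ * Real.exp (-(C * T))) ⊆ U := fun x hx z hz => by
    by_contra hzU
    obtain ⟨t, ht, htψ⟩ : ∃ t ∈ Icc 0 T, Ψ t x ∈ tsupport ψ := by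
      by_contra! hne
      refine hx ?_
      rw [flowIntegral, intervalIntegral.integral_congr (g := fun _ => 0),
        intervalIntegral.integral_zero]
      intro t ht
      rw [uIcc_of_le hT] at ht
      simp only
      rw [max_eq_left ht.1]
      exact image_eq_zero_of_notMem_tsupport (hne t ht)
    refine hzU (hδU (Metric.mem_thickening_iff.2 ⟨_, htψ, ?_⟩))
    have h1 := h.dist_le hv ht.1 z x
    rw [h.eq_self_of_eq_zero hv (hvU z hzU) ht.1] at h1
    have h2 : Real.exp (C * t) ≤ Real.exp (C * T) := by gcongr; exact ht.2
    calc dist z (Ψ t x) ≤ dist z x * Real.exp (C * T) :=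
          h1.trans (mul_le_mul_of_nonneg_left h2 dist_nonneg)
      _ < δ * Real.exp (-(C * T)) * Real.exp (C * T) :=
          mul_lt_mul_of_pos_right hz (Real.exp_pos _)
      _ = δ := by rw [mul_assoc, ← Real.exp_add]; simp
  intro x hx
  obtain ⟨y, hy, hxy⟩ := Metric.mem_closure_iff.1 hx _ (mul_pos hδ (Real.exp_pos (-(C * T))))
  exact hball y hy hxy

end CutoffSemiflow

theorem IsOpen.exists_compact_exhaustion {E : Type*} [TopologicalSpace E] [LocallyCompactSpace E]
    [SecondCountableTopology E] [T2Space E] {Y : Set E} (hY : IsOpen Y) :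
    ∃ K : ℕ → Set E, (∀ k, IsCompact (K k)) ∧ (∀ k, K k ⊆ Y) ∧
      ∀ L, IsCompact L → L ⊆ Y → ∀ᶠ k in atTop, L ⊆ K k := by
  have : LocallyCompactSpace Y := hY.locallyCompactSpace
  let e : CompactExhaustion Y := default
  refine ⟨fun k => Subtype.val '' e k, fun k => (e.isCompact k).image continuous_subtype_val,
    fun k => by rintro _ ⟨x, -, rfl⟩; exact x.2, fun L hL hLY => ?_⟩
  have hL' : IsCompact ((Subtype.val : Y → E) ⁻¹' L) := by
    rw [Subtype.isCompact_iff, Subtype.image_preimage_coe, inter_eq_right.2 hLY]; exact hL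
  obtain ⟨N, hN⟩ := e.exists_superset_of_isCompact hL'
  filter_upwards [eventually_ge_atTop N] with k hk x hx
  exact ⟨⟨x, hLY hx⟩, e.subset hk (hN hx), rfl⟩

/-! ### Minimality of the occupancy density -/

namespace SafeControlProblem

variable {n m : ℕ} {P : SafeControlProblem n m}
  {u : EuclideanSpace ℝ (Fin n) → EuclideanSpace ℝ (Fin m)}
  {ρ : EuclideanSpace ℝ (Fin n) → ℝ≥0∞}

/-- A nonnegative solution of the Liouville equation dominates the occupation of the cut-off
dynamics up to a finite time. -/
theorem SolvesLiouville.lintegral_flowIntegral_le (hu : P.IsPolicy u) (hρ : Measurable ρ)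
    (hL : P.SolvesLiouville u ρ) {χ ψ : EuclideanSpace ℝ (Fin n) → ℝ} {C D : ℝ≥0}
    {Ψ : ℝ → EuclideanSpace ℝ (Fin n) → EuclideanSpace ℝ (Fin n)}
    (hχ : Continuous χ) (hχ0 : ∀ x, 0 ≤ χ x) (hχc : HasCompactSupport χ)
    (hχY : tsupport χ ⊆ P.X \ P.Xr) (hv : LipschitzWith C fun x => χ x • P.field u x)
    (hΨ : IsSemiflow (fun x => χ x • P.field u x) Ψ) (hψ : LipschitzWith D ψ)
    (hψ0 : ∀ x, 0 ≤ ψ x) (hψc : HasCompactSupport ψ) (hψχ : ∀ x ∈ tsupport ψ, χ x = 1)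
    {T : ℝ} (hT : 0 ≤ T) :
    ∫⁻ x, (∫⁻ t in Ioc 0 T, ENNReal.ofReal (ψ (Ψ (max t 0) x))) ∂P.initLaw ≤
      ∫⁻ x in P.X \ P.Xr, ENNReal.ofReal (ψ x) * ρ x := by
  set U : Set (EuclideanSpace ℝ (Fin n)) := {x | 0 < χ x} with hU
  have hUo : IsOpen U := isOpen_lt continuous_const hχ
  have hUχ : U ⊆ tsupport χ := fun x hx => subset_tsupport _ (ne_of_gt hx)
  have hψU : tsupport ψ ⊆ U := fun x hx => by
    rw [hU, mem_ofPred_eq, hψχ x hx]; exact one_pos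
  have hψY : tsupport ψ ⊆ P.X \ P.Xr := hψU.trans (hUχ.trans hχY)
  set φ := flowIntegral Ψ ψ T with hφ
  have hφL := hΨ.lipschitzWith_flowIntegral hv hψ hT
  have hφU : tsupport φ ⊆ U := hΨ.tsupport_flowIntegral_subset hv hψc hT hUo hψU fun z hz => by
    rw [le_antisymm (not_lt.1 hz) (hχ0 z), zero_smul]
  have hφc : HasCompactSupport φ :=
    hχc.isCompact.of_isClosed_subset (isClosed_tsupport _) (hφU.trans hUχ)
  have hφY : tsupport φ ⊆ P.X \ P.Xr := hφU.trans (hUχ.trans hχY)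
  have hφ0 : ∀ x, 0 ≤ φ x := fun x => intervalIntegral.integral_nonneg hT fun t _ => hψ0 _
  -- The derivative of `φ` along `χF` is `ψ ∘ Ψ_T - ψ`. On the support of `ψ` one has `χ = 1`;
  -- elsewhere in `U` one divides by `χ > 0`; off `U`, `φ` vanishes locally.
  have hderiv : ∀ᵐ x, -fderiv ℝ φ x (P.field u x) ≤ ψ x := by
    filter_upwards [hφL.ae_differentiableAt] with x hx
    by_cases hxU : x ∈ U
    · have h1 := hΨ.fderiv_flowIntegral hv hψ.continuous hT hx
      rw [map_smul, smul_eq_mul] at h1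
      have hχx : 0 < χ x := hxU
      by_cases hxψ : x ∈ tsupport ψ
      · rw [hψχ x hxψ, one_mul] at h1
        linarith [hψ0 (Ψ T x)]
      · rw [image_eq_zero_of_notMem_tsupport hxψ, sub_zero] at h1
        rw [image_eq_zero_of_notMem_tsupport hxψ, neg_nonpos]
        exact nonneg_of_mul_nonneg_right (h1 ▸ hψ0 _) hχx
    · rw [fderiv_of_notMem_tsupport ℝ fun h => hxU (hφU h)]
      simpa using hψ0 x
  have hψρ : IntegrableOn (fun x => ψ x * (ρ x).toReal) (P.X \ P.Xr) := by
    obtain ⟨M, hM⟩ := hψc.exists_bound_of_continuous hψ.continuous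
    have h1 : IntegrableOn (fun x => M * (ρ x).toReal) (tsupport ψ) :=
      (hL.integrableOn_toReal hρ hψc.isCompact hψY).const_mul M
    rw [← integrable_indicator_iff hψc.isCompact.measurableSet] at h1
    refine (h1.restrict (s := P.X \ P.Xr)).mono'
      (hψ.continuous.measurable.mul hρ.ennreal_toReal).aestronglyMeasurable
      (.of_forall fun x => ?_)
    by_cases hx : x ∈ tsupport ψ
    · rw [indicator_of_mem hx, norm_mul, Real.norm_of_nonneg ENNReal.toReal_nonneg]
      exact mul_le_mul_of_nonneg_right (hM x) ENNReal.toReal_nonneg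
    · rw [indicator_of_notMem hx, image_eq_zero_of_notMem_tsupport hx, zero_mul, norm_zero]
  have hψρ0 : ∀ x, 0 ≤ ψ x * (ρ x).toReal := fun x => mul_nonneg (hψ0 x) ENNReal.toReal_nonneg
  have hreal : ∫ x, φ x ∂P.initLaw ≤ ∫ x in P.X \ P.Xr, ψ x * (ρ x).toReal := by
    rw [← setIntegral_mul_h₀ φ fun x _ hx =>
      image_eq_zero_of_notMem_tsupport fun h => hx (hφY h),
      ← hL.of_lipschitzWith hu hρ hφL hφc hφY, ← integral_neg]
    by_cases hi : IntegrableOn (fun x => -(fderiv ℝ φ x (P.field u x) * (ρ x).toReal)) (P.X \ P.Xr)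
    · refine integral_mono_ae hi hψρ ?_
      filter_upwards [ae_restrict_of_ae hderiv] with x hx
      rw [← neg_mul]
      exact mul_le_mul_of_nonneg_right hx ENNReal.toReal_nonneg
    -- A non-integrable function has integral 0 by convention, and the right side is nonnegative.
    · rw [integral_undef hi]
      exact integral_nonneg hψρ0
  have hφi : Integrable φ P.initLaw := hφL.continuous.integrable_of_hasCompactSupport hφc
  calc ∫⁻ x, (∫⁻ t in Ioc 0 T, ENNReal.ofReal (ψ (Ψ (max t 0) x))) ∂P.initLaw
      = ∫⁻ x, ENNReal.ofReal (φ x) ∂P.initLaw := lintegral_congr fun x => by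
        rw [hφ, flowIntegral, intervalIntegral.integral_of_le hT,
          ofReal_integral_eq_lintegral_ofReal _ (.of_forall fun t => hψ0 _)]
        exact ((hΨ.continuous_observable hv hψ.continuous x).intervalIntegrable 0 T).1
    _ = ENNReal.ofReal (∫ x, φ x ∂P.initLaw) :=
        (ofReal_integral_eq_lintegral_ofReal hφi (.of_forall hφ0)).symm
    _ ≤ ENNReal.ofReal (∫ x in P.X \ P.Xr, ψ x * (ρ x).toReal) := ENNReal.ofReal_le_ofReal hreal
    _ = ∫⁻ x in P.X \ P.Xr, ENNReal.ofReal (ψ x * (ρ x).toReal) :=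
        ofReal_integral_eq_lintegral_ofReal hψρ (.of_forall hψρ0)
    _ ≤ ∫⁻ x in P.X \ P.Xr, ENNReal.ofReal (ψ x) * ρ x := lintegral_mono fun x => by
        rw [ENNReal.ofReal_mul (hψ0 x)]
        gcongr
        exact ENNReal.ofReal_toReal_le

/-- If a trajectory is outside `X_r` at time `t`, it was so on all of `[0, t]`. This segment is
compact, so late cut-offs do not alter it and `Ψ k` follows the true flow. Fatou then passes to the
limit. -/
theorem SolvesLiouville.lintegral_flow_le (hu : P.IsPolicy u) (hρ : Measurable ρ)
    (hL : P.SolvesLiouville u ρ) (hstay : P.StaysInTarget u)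
    {ψ : EuclideanSpace ℝ (Fin n) → ℝ} {D : ℝ≥0} (hψ : LipschitzWith D ψ)
    (hψ0 : ∀ x, 0 ≤ ψ x) (hψc : HasCompactSupport ψ) (hψY : tsupport ψ ⊆ P.X \ P.Xr) :
    ∫⁻ x, (∫⁻ t in Ici (0 : ℝ), ENNReal.ofReal (ψ (P.flow u t x))) ∂P.initLaw ≤
      ∫⁻ x in P.X \ P.Xr, ENNReal.ofReal (ψ x) * ρ x := by
  obtain ⟨K, hKc, hKY, hKex⟩ := P.isOpen_diff.exists_compact_exhaustion
  have hfY : LocallyLipschitzOn (P.X \ P.Xr) (P.field u) := hu.locallyLipschitz.mono sdiff_subset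
  choose χ hχ hχ0 hχ1 hχc hχY hlip hbd using fun k => exists_cutoff P.isOpen_diff hfY
    ((hKc k).union hψc.isCompact) (union_subset (hKY k) hψY)
  choose C hC using hlip
  choose M hM using hbd
  choose Ψ hΨ using fun k => exists_isSemiflow (hC k) (hM k)
  have hχ1' : ∀ k, ∀ x ∈ K k ∪ tsupport ψ, χ k x = 1 := fun k x hx => by
    obtain ⟨ε, -, h⟩ := hχ1 k
    exact h x (Metric.self_subset_cthickening _ hx)
  let H : ℕ → EuclideanSpace ℝ (Fin n) × ℝ → ℝ≥0∞ := fun k q =>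
    (Ioc (0 : ℝ) k).indicator 1 q.2 * ENNReal.ofReal (ψ (Ψ k (max q.2 0) q.1))
  have hHm : ∀ k, Measurable (H k) := fun k => by
    refine ((measurable_one.indicator measurableSet_Ioc).comp measurable_snd).mul ?_
    exact (hψ.continuous.comp
      (((hΨ k).continuous_max (hC k)).comp continuous_swap)).measurable.ennreal_ofReal
  have hHle : ∀ k, ∫⁻ q, H k q ∂P.initLaw.prod (volume.restrict (Ici (0 : ℝ))) ≤
      ∫⁻ x in P.X \ P.Xr, ENNReal.ofReal (ψ x) * ρ x := fun k => by
    refine le_trans (le_of_eq ?_) (hL.lintegral_flowIntegral_le hu hρ (hχ k) (hχ0 k) (hχc k)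
      (hχY k) (hC k) (hΨ k) hψ hψ0 hψc (fun x hx => hχ1' k x (Or.inr hx)) (Nat.cast_nonneg k))
    rw [lintegral_prod _ (hHm k).aemeasurable]
    refine lintegral_congr fun x => ?_
    have h1 : ∀ t, H k (x, t) = (Ioc (0 : ℝ) k).indicator
        (fun t => ENNReal.ofReal (ψ (Ψ k (max t 0) x))) t := fun t => by
      by_cases ht : t ∈ Ioc (0 : ℝ) k <;> simp [H, ht]
    simp_rw [h1]
    rw [lintegral_indicator measurableSet_Ioc, Measure.restrict_restrict measurableSet_Ioc,
      inter_eq_left.2 (Ioc_subset_Ioi_self.trans Ioi_subset_Ici_self)]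
  have hpt : ∀ x ∈ P.X₀, ∀ t, 0 < t →
      ENNReal.ofReal (ψ (P.flow u t x)) ≤ liminf (fun k => H k (x, t)) atTop := fun x hx t ht => by
    have hxX := P.X₀_subset hx
    by_cases htY : P.flow u t x ∈ P.X \ P.Xr
    · have hsub : (fun r => P.flow u r x) '' Icc 0 t ⊆ P.X \ P.Xr := by
        rintro _ ⟨r, hr, rfl⟩
        exact ⟨hu.flow_mem hxX hr.1, fun h => htY.2 (hstay x hx r t hr.1 hr.2 h)⟩
      have hcomp := isCompact_Icc.image_of_continuousOn (hu.solvesOn_flow hxX t).continuousOn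
      refine le_liminf_of_le (by isBoundedDefault) ?_
      filter_upwards [hKex _ hcomp hsub, eventually_ge_atTop ⌈t⌉₊] with k hk hkt
      have hflow : Ψ k t x = P.flow u t x := by
        have := (hΨ k).eq_of_solvesOn (hC k) (γ := fun r => P.flow u r x) (T := t)
          ((hu.solvesOn_flow hxX t).congr_field fun r hr => by
            rw [hχ1' k _ (Or.inl (hk ⟨r, hr, rfl⟩)), one_smul]) ⟨ht.le, le_rfl⟩
        rwa [hu.flow_zero hxX] at this
      have htk : t ∈ Ioc (0 : ℝ) k := ⟨ht, Nat.ceil_le.1 hkt⟩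
      simp [H, htk, max_eq_left ht.le, hflow]
    · rw [image_eq_zero_of_notMem_tsupport fun h => htY (hψY h)]
      simp
  have hm : Measurable fun q : EuclideanSpace ℝ (Fin n) × ℝ => liminf (fun k => H k q) atTop :=
    .liminf hHm
  calc ∫⁻ x, (∫⁻ t in Ici (0 : ℝ), ENNReal.ofReal (ψ (P.flow u t x))) ∂P.initLaw
      ≤ ∫⁻ x, (∫⁻ t in Ici (0 : ℝ), liminf (fun k => H k (x, t)) atTop) ∂P.initLaw := by
        refine lintegral_mono_ae ?_
        filter_upwards [P.ae_initLaw_mem_X₀] with x hx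
        -- Time 0 is discarded as a null set, because `H` vanishes there.
        rw [← restrict_Ioi_eq_restrict_Ici]
        exact setLIntegral_mono' measurableSet_Ioi fun t ht => hpt x hx t ht
    _ = ∫⁻ q, liminf (fun k => H k q) atTop ∂P.initLaw.prod (volume.restrict (Ici (0 : ℝ))) :=
        (lintegral_prod _ hm.aemeasurable).symm
    _ ≤ liminf (fun k => ∫⁻ q, H k q ∂P.initLaw.prod (volume.restrict (Ici (0 : ℝ)))) atTop :=
        lintegral_liminf_le hHm
    _ ≤ _ := by
        refine liminf_le_of_le (by isBoundedDefault) fun b hb => ?_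
        obtain ⟨k, hk⟩ := hb.exists
        exact hk.trans (hHle k)

/-- The occupancy density is the smallest nonnegative solution of the Liouville equation. -/
theorem SolvesLiouville.occupancyDensity_le (hu : P.IsPolicy u) (hρ : Measurable ρ)
    (hL : P.SolvesLiouville u ρ) (hstay : P.StaysInTarget u)
    {ρ' : EuclideanSpace ℝ (Fin n) → ℝ≥0∞} (hρ' : P.IsOccupancyDensity u ρ') :
    ∀ᵐ x, x ∈ P.X \ P.Xr → ρ' x ≤ ρ x := by
  have hYm := P.isOpen_diff.measurableSet
  have hcompact : ∀ K, IsCompact K → K ⊆ P.X \ P.Xr → ∫⁻ x in K, ρ' x ≤ ∫⁻ x in K, ρ x :=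
      fun K hK hKY => by
    obtain ⟨δ, hδ, hδY⟩ := hK.exists_cthickening_subset_open P.isOpen_diff hKY
    set S := Metric.cthickening δ K with hS
    have hSc : IsCompact S := hK.cthickening
    let δs : ℕ → ℝ := fun k => δ / (k + 1)
    have hδs : ∀ k, 0 < δs k := fun k => by positivity
    have hδs0 : Tendsto δs atTop (𝓝 0) := by
      have := (tendsto_const_div_atTop_nhds_zero_nat δ).comp (tendsto_add_atTop_nat 1)
      refine this.congr fun k => ?_
      simp [δs]
    have hδsS : ∀ k, Metric.thickening (δs k) K ⊆ S := fun k =>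
      (Metric.thickening_subset_cthickening _ _).trans (Metric.cthickening_mono
        (div_le_self hδ.le (by linarith [(Nat.cast_nonneg k : (0 : ℝ) ≤ k)])) K)
    -- Restricting to `S` makes the measure finite, so integrals of the thickened indicators
    -- converge to the mass of `K`.
    let μ := (volume.restrict S).withDensity ρ
    have hfin : IsFiniteMeasure μ := isFiniteMeasure_withDensity (hL.1 S hSc hδY).ne
    have hlim := tendsto_lintegral_thickenedIndicator_of_isClosed μ hK.isClosed hδs hδs0
    have hμK : μ K = ∫⁻ x in K, ρ x := by
      rw [withDensity_apply _ hK.measurableSet, Measure.restrict_restrict hK.measurableSet,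
        inter_eq_left.2 (Metric.self_subset_cthickening K)]
    rw [hμK] at hlim
    refine ge_of_tendsto' hlim fun k => ?_
    set ψ : EuclideanSpace ℝ (Fin n) → ℝ := fun x => (thickenedIndicator (hδs k) K x : ℝ) with hψ
    have hψo : ∀ x, ENNReal.ofReal (ψ x) = (thickenedIndicator (hδs k) K x : ℝ≥0∞) := fun x =>
      ENNReal.ofReal_coe_nnreal
    have hψS : ∀ x, x ∉ S → ψ x = 0 := fun x hx => by
      simp only [hψ]
      rw [thickenedIndicator_zero (hδs k) K fun h => hx (hδsS k h)]; rfl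
    have hψsupp : tsupport ψ ⊆ S :=
      closure_minimal (fun x hx => by by_contra h; exact hx (hψS x h)) hSc.isClosed
    have hψL : LipschitzWith (δs k).toNNReal⁻¹ ψ := fun x y =>
      lipschitzWith_thickenedIndicator (hδs k) K x y
    have hψm : Measurable fun x => ENNReal.ofReal (ψ x) := hψL.continuous.measurable.ennreal_ofReal
    calc ∫⁻ x in K, ρ' x ≤ ∫⁻ x in P.X, ENNReal.ofReal (ψ x) * ρ' x := by
          rw [← lintegral_indicator hK.measurableSet,
            ← lintegral_indicator P.isOpen_X.measurableSet]
          refine lintegral_mono fun x => ?_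
          by_cases hx : x ∈ K
          · rw [indicator_of_mem hx, indicator_of_mem (hKY hx).1, hψo,
              thickenedIndicator_one (hδs k) K hx]
            simp
          · rw [indicator_of_notMem hx]; exact zero_le
      _ = ∫⁻ x, (∫⁻ t in Ici (0 : ℝ), ENNReal.ofReal (ψ (P.flow u t x))) ∂P.initLaw :=
          hρ'.setLIntegral_mul hu hψm
      _ ≤ ∫⁻ x in P.X \ P.Xr, ENNReal.ofReal (ψ x) * ρ x :=
          hL.lintegral_flow_le hu hρ hstay hψL (fun x => NNReal.coe_nonneg _)
            (hSc.of_isClosed_subset (isClosed_tsupport _) hψsupp) (hψsupp.trans hδY)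
      _ = ∫⁻ x in S, ENNReal.ofReal (ψ x) * ρ x := by
          rw [← lintegral_indicator hYm, ← lintegral_indicator hSc.measurableSet]
          refine lintegral_congr fun x => ?_
          by_cases hx : x ∈ S
          · rw [indicator_of_mem hx, indicator_of_mem (hδY hx)]
          · rw [indicator_of_notMem hx, indicator_apply_eq_zero]
            intro; rw [hψS x hx]; simp
      _ = ∫⁻ x, (thickenedIndicator (hδs k) K x : ℝ≥0∞) ∂μ := by
          simp_rw [← hψo]
          rw [lintegral_withDensity_eq_lintegral_mul _ hρ hψm]
          simp only [Pi.mul_apply, mul_comm]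
  have hBm : MeasurableSet ((P.X \ P.Xr) ∩ {x | ρ x < ρ' x}) :=
    hYm.inter (measurableSet_lt hρ hρ'.measurable)
  have hB : volume ((P.X \ P.Xr) ∩ {x | ρ x < ρ' x}) = 0 := by
    by_contra hne
    -- Inner regularity gives a compact set of positive measure on which `ρ < ρ'`; as `ρ` has finite
    -- integral over it, the comparison on compact sets is violated.
    obtain ⟨K, hKB, hKc, hK0⟩ := hBm.exists_lt_isCompact (pos_iff_ne_zero.2 hne)
    refine absurd (hcompact K hKc (hKB.trans inter_subset_left)) (not_le.2 ?_)
    exact setLIntegral_strict_mono hKc.measurableSet hK0.ne' hρ'.measurable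
      (hL.1 K hKc (hKB.trans inter_subset_left)).ne (.of_forall fun x hx => (hKB hx).2)
  filter_upwards [measure_eq_zero_iff_ae_notMem.1 hB] with x hx hxY
  by_contra h
  exact hx ⟨hxY, not_le.1 h⟩

end SafeControlProblem

/-! ### Feasible pairs and equality of the values -/

namespace SafeControlProblem

variable {n m : ℕ} {P : SafeControlProblem n m}
  {u : EuclideanSpace ℝ (Fin n) → EuclideanSpace ℝ (Fin m)}
  {ρ : EuclideanSpace ℝ (Fin n) → ℝ≥0∞}

theorem IsOccupancyDensity.isFeasible_iff (hu : P.IsPolicy u) (hρ : P.IsOccupancyDensity u ρ)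
    (hdrive : P.DrivesToTarget u) (hfin : P.HasFiniteOccupancy u) :
    P.IsFeasible u ρ ↔ P.IsSafeAE u := by
  rw [hρ.isSafeAE_iff hu]
  exact ⟨fun h => h.safe, fun h => ⟨hρ.measurable, hρ.solvesLiouville hu hdrive hfin, h⟩⟩

/-- Minimality says nothing on `X_r`. Disjointness from `X_u` and the vanishing of the cost there
make neither safety nor cost depend on it. -/
theorem IsFeasible.isSafeAE_and_cost_le (hu : P.IsPolicy u) (hρ : P.IsFeasible u ρ)
    (hdisj : Disjoint P.Xu P.Xr) (hstay : P.StaysInTarget u)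
    (hl : ∀ x ∈ P.Xr, P.l x (u x) = 0) :
    P.IsSafeAE u ∧ P.cost u ≤ P.occupancyCost u ρ := by
  obtain ⟨ρ', hρ'⟩ := hu.exists_isOccupancyDensity
  have hle := hρ.liouville.occupancyDensity_le hu hρ.measurable hstay hρ'
  refine ⟨?_, ?_⟩
  · rw [hρ'.isSafeAE_iff hu, ← nonpos_iff_eq_zero, ← hρ.safe]
    refine lintegral_mono_ae ?_
    filter_upwards [ae_restrict_of_ae hle, ae_restrict_mem P.measurableSet_Xu] with x hx hxu
    exact hx ⟨P.Xu_subset hxu, disjoint_left.1 hdisj hxu⟩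
  · rw [hρ'.cost_eq hu]
    refine lintegral_mono_ae ?_
    filter_upwards [ae_restrict_of_ae hle, ae_restrict_mem P.isOpen_X.measurableSet] with x hx hxX
    by_cases hxr : x ∈ P.Xr
    · simp [hl x hxr]
    · gcongr
      exact hx ⟨hxX, hxr⟩

end SafeControlProblem

end

theorem mainTheorem1 {n m : ℕ} (P : SafeControlProblem n m) :
    -- a fixed policy
    (∀ u, P.IsPolicy u →
      -- the occupancy density exists and is unique up to null sets
      (∃ ρ, P.IsOccupancyDensity u ρ) ∧
      (∀ ρ ρ', P.IsOccupancyDensity u ρ → P.IsOccupancyDensity u ρ' →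
        ρ =ᵐ[volume.restrict P.X] ρ') ∧
      (P.IsSafe u → P.IsSafeAE u) ∧
      (IsOpen P.Xu → (∀ x ∈ P.X₀, ∀ V ∈ 𝓝 x, 0 < ∫⁻ y in V, ENNReal.ofReal (P.h₀ y)) →
        (P.IsSafe u ↔ P.IsSafeAE u)) ∧
      ∀ ρ, P.IsOccupancyDensity u ρ →
        -- the cost, for nonnegative and for absolutely integrable running costs
        ((∀ x ∈ P.X, ∀ v, 0 ≤ P.l x v) → P.cost u = P.occupancyCost u ρ) ∧
        (∫⁻ x in P.X, (∫⁻ t in Ici (0 : ℝ),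
            ‖P.l (P.flow u t x) (u (P.flow u t x))‖ₑ) * ENNReal.ofReal (P.h₀ x) < ⊤ →
          IntegrableOn (fun x => P.l x (u x) * (ρ x).toReal) P.X ∧
          ∫ x in P.X, (∫ t in Ici (0 : ℝ),
            P.l (P.flow u t x) (u (P.flow u t x))) * P.h₀ x =
              ∫ x in P.X, P.l x (u x) * (ρ x).toReal) ∧
        -- the occupancy identity and the safety constraint
        (∀ A, MeasurableSet A → A ⊆ P.X →
          ∫⁻ x in A, ρ x = ∫⁻ x in P.X, P.timeIn u A x * ENNReal.ofReal (P.h₀ x)) ∧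
        (P.IsSafeAE u ↔ ∫⁻ x in P.Xu, ρ x = 0) ∧
        -- the steady Liouville equation outside the target set
        (P.DrivesToTarget u → P.HasFiniteOccupancy u →
          P.SolvesLiouville u ρ ∧
          (∀ V, IsOpen V → V ⊆ P.X \ P.Xr → ContinuousOn P.h₀ V →
            ∀ g : EuclideanSpace ℝ (Fin n) → ℝ,
              (∀ᵐ x ∂(volume.restrict V), g x = (ρ x).toReal) →
              ContDiffOn ℝ 1 (fun x => g x • P.field u x) V →
                ∀ x ∈ V, divergence (fun y => g y • P.field u y) x = P.h₀ x) ∧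
          (P.IsFeasible u ρ ↔ P.IsSafeAE u))) ∧
    -- the optimization problems
    ∀ 𝒰 : Set (EuclideanSpace ℝ (Fin n) → EuclideanSpace ℝ (Fin m)),
      (∀ u ∈ 𝒰, P.IsPolicy u ∧ P.DrivesToTarget u ∧ P.HasFiniteOccupancy u) →
      (∀ x ∈ P.X, ∀ v, 0 ≤ P.l x v) →
        P.controlValueAE 𝒰 = P.occupancyValueOfDensity 𝒰 ∧
        (Disjoint P.Xu P.Xr →
          (∀ u ∈ 𝒰, P.StaysInTarget u ∧ ∀ x ∈ P.Xr, P.l x (u x) = 0) →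
            P.controlValueAE 𝒰 = P.occupancyValue 𝒰 ∧
            ∀ u ∈ 𝒰, ∀ ρ, P.IsFeasible u ρ →
              P.IsSafeAE u ∧ P.cost u ≤ P.occupancyCost u ρ) ∧
        (IsOpen P.Xu → (∀ x ∈ P.X₀, ∀ V ∈ 𝓝 x, 0 < ∫⁻ y in V, ENNReal.ofReal (P.h₀ y)) →
          P.controlValue 𝒰 = P.controlValueAE 𝒰) := by
  refine ⟨fun u hu => ⟨hu.exists_isOccupancyDensity, fun ρ ρ' hρ hρ' => hρ.ae_eq hu hρ',
    fun h => h.isSafeAE, fun hXu hpos => ⟨fun h => h.isSafeAE, hu.isSafe_of_isSafeAE hXu hpos⟩,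
    fun ρ hρ => ⟨fun _ => hρ.cost_eq hu, fun hfin => ?_, fun A hA hAX => ?_, hρ.isSafeAE_iff hu,
      fun hdrive hfin => ⟨hρ.solvesLiouville hu hdrive hfin, fun V hV hVY hh g hg hw =>
        (hρ.solvesLiouville hu hdrive hfin).divergence_eq hV hVY hh hg hw,
        hρ.isFeasible_iff hu hdrive hfin⟩⟩⟩, fun 𝒰 h𝒰 _ => ⟨?_, fun hdisj hstay => ?_, ?_⟩⟩
  · rw [SafeControlProblem.setLIntegral_mul_h₀] at hfin
    obtain ⟨hint, hid⟩ := hρ.setIntegral_mul hu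
      (P.measurable_l.comp (measurable_id.prodMk hu.measurable)) hfin
    refine ⟨hint, ?_⟩
    rw [SafeControlProblem.setIntegral_mul_h₀ _ fun x hx hxX => absurd (P.X₀_subset hx) hxX]
    exact hid
  · rw [SafeControlProblem.setLIntegral_mul_h₀, hρ.setLIntegral hu hA hAX]
  · refine le_antisymm (le_iInf₂ fun u hu => le_iInf₂ fun ρ hρ => ?_)
      (le_iInf₂ fun u hu => ?_)
    · obtain ⟨hpol, hdrive, hfin⟩ := h𝒰 u hu
      rw [← hρ.2.cost_eq hpol]
      exact iInf₂_le u ⟨hu, (hρ.2.isFeasible_iff hpol hdrive hfin).1 hρ.1⟩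
    · obtain ⟨hpol, hdrive, hfin⟩ := h𝒰 u hu.1
      obtain ⟨ρ, hρ⟩ := hpol.exists_isOccupancyDensity
      rw [hρ.cost_eq hpol]
      exact iInf₂_le_of_le u hu.1
        (iInf₂_le ρ ⟨(hρ.isFeasible_iff hpol hdrive hfin).2 hu.2, hρ⟩)
  · have hfeas : ∀ u ∈ 𝒰, ∀ ρ, P.IsFeasible u ρ →
        P.IsSafeAE u ∧ P.cost u ≤ P.occupancyCost u ρ := fun u hu ρ hρ =>
      hρ.isSafeAE_and_cost_le (h𝒰 u hu).1 hdisj (hstay u hu).1 (hstay u hu).2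
    -- Minimality bounds the occupancy value from below; the occupancy density itself is a
    -- competitor that attains the cost.
    refine ⟨le_antisymm (le_iInf₂ fun u hu => le_iInf₂ fun ρ hρ => ?_)
      (le_iInf₂ fun u hu => ?_), hfeas⟩
    · obtain ⟨hsafe, hle⟩ := hfeas u hu ρ hρ
      exact (iInf₂_le u ⟨hu, hsafe⟩).trans hle
    · obtain ⟨hpol, hdrive, hfin⟩ := h𝒰 u hu.1
      obtain ⟨ρ, hρ⟩ := hpol.exists_isOccupancyDensity
      rw [hρ.cost_eq hpol]
      exact iInf₂_le_of_le u hu.1 (iInf₂_le ρ ((hρ.isFeasible_iff hpol hdrive hfin).2 hu.2))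
  · intro hXu hpos
    have : {u ∈ 𝒰 | P.IsSafe u} = {u ∈ 𝒰 | P.IsSafeAE u} := by
      ext u
      exact and_congr_right fun hu =>
        ⟨fun h => h.isSafeAE, (h𝒰 u hu).1.isSafe_of_isSafeAE hXu hpos⟩
    rw [SafeControlProblem.controlValue, SafeControlProblem.controlValueAE, this]
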